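/- **Setting.** Let $d\in\mathbb N$, let $\mathcal H$ be a complex Hilbert space (inner products are conjugate linear in the first argument), let $\mathbb F^d$ be the free monoid on $d$ letters with unit $\emptyset$ and word reversal $\alpha\mapsto\alpha^\dagger$, and let $\mathbb B^d_n$ be the set of $Z=(Z_1,\dots,Z_d)\in(\mathbb C^{n\times n})^d$ with $\sum_j Z_jZ_j^*<I$. Write $Z^\alpha=Z_{i_1}\cdots Z_{i_k}$ for $\alpha=i_1\cdots i_k$. Let $B$ be in the operator-valued left free Schur class: $B$ is a free function on $\bigsqcup_n\mathbb B^d_n$ (it respects the grading and intertwinings) with $B(Z)\in\mathbb C^{n\times n}\otimes\mathcal L(\mathcal H)$, and $f\mapsto Bf$ is a contraction of the free Hardy space of functions $f(Z)=\sum_\alpha Z^\alpha\otimes f_\alpha$, $(f_\alpha)\in\ell^2(\mathbb F^d;\mathcal H)$, into itself. Assume that $I-B(Z)$ is invertible for every $Z$ in the ball, and set $H_B=(I+B)(I-B)^{-1}$. Let $K(Z,W)[P]=\sum_\alpha Z^\alpha P(W^\alpha)^*$ and $$K^{H_B}(Z,W)[P]=\tfrac12\big(H_B(Z)(K(Z,W)[P]\otimes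 I)+(K(Z,W)[P]\otimes I)H_B(W)^*\big).$$ The left free Herglotz space $\mathscr H^L_+(H_B)$ is the Hilbert space completion of the span of the kernel vectors $K^{H_B}\{Z,y,v\}h$ ($Z\in\mathbb B^d_n$, $y,v\in\mathbb C^n$, $h\in\mathcal H$) with inner product $\langle K^{H_B}\{Z,y,v\}h,K^{H_B}\{W,x,u\}g\rangle=\langle y\otimes h,K^{H_B}(Z,W)[vu^*](x\otimes g)\rangle$; its elements are the free functions $F$ with values in $\mathbb C^{n\times n}\otimes\mathcal H$ given by $\langle y\otimes h,F(Z)v\rangle=\langle K^{H_B}\{Z,y,v\}h,F\rangle$. For a free function $F$ let $F_\alpha$ be its Taylor–Taylor coefficients at $0$, and let $K^{H_B}_\alpha:\mathcal H\to\mathscr H^L_+(H_B)$ be the adjoint of $F\mapsto F_\alpha$. Write $H_\alpha$ for the Taylor–Taylor coefficients of $H_B$. Let $L_1,\dots,L_d$ be the left free shifts on the full Fock space and let $\mu_B$ be the Clark map, $\mu_B(L^\alpha)=\tfrac12\big(H_\emptyset\,\delta_{\alpha,\emptyset}+H_{\alpha^\dagger}^*\big)$, $\mu_B((L^\alpha)^*)=\mu_B(L^\alpha)^*$.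 Let $F^2(\mu_B)$ be the completion (modulo vectors of length zero) of the span of the $L^\alpha\otimes h$ with $\langle L^\alpha\otimes h,L^\beta\otimes g\rangle=\langle h,\mu_B((L^\alpha)^*L^\beta)g\rangle$, let $\pi_{\mu_B}(L_j)(L^\alpha\otimes h)=L_jL^\alpha\otimes h$, and let $\mathcal C^L:F^2(\mu_B)\to\mathscr H^L_+(H_B)$ be the Cauchy transform, the bounded operator with $\mathcal C^L(L^\alpha\otimes h)=K^{H_B}_{\alpha^\dagger}h$. Put $$V^B_j=\mathcal C^L\,\pi_{\mu_B}(L_j)\,(\mathcal C^L)^*,\qquad V^B=(V^B_1,\dots,V^B_d):\mathscr H^L_+(H_B)\otimes\mathbb C^d\to\mathscr H^L_+(H_B).$$ **Proposition.** For all $Z$ in the ball, $H_B(Z)=\sum_\alpha Z^\alpha\otimes H_\alpha$ (unconditionally, in the strong operator topology) and $F(Z)=\sum_\alpha Z^\alpha\otimes F_\alpha$ for every $F\in\mathscr H^L_+(H_B)$. Moreover: 1. $V^B$ is a row isometry, and its range is $$\mathcal R=\bigvee_{n,\,Z\in\mathbb B^d_n,\,y,v\in\mathbb C^n,\,h\in\mathcal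 H}\big(K^{H_B}\{Z,y,v\}h-K^{H_B}\{0_n,y,v\}h\big)=\bigvee_{\alpha\ne\emptyset,\,h\in\mathcal H}K^{H_B}_\alpha h,$$ where $\bigvee$ denotes closed linear span. 2. For all $n$, $Z\in\mathbb B^d_n$, $y,v\in\mathbb C^n$, $h\in\mathcal H$ and $j=1,\dots,d$, $$(V^B_j)^*\big(K^{H_B}\{Z,y,v\}h-K^{H_B}\{0_n,y,v\}h\big)=K^{H_B}\{Z,y,Z_jv\}h,$$ and the vectors $\big(K^{H_B}\{Z,y,Z_jv\}h\big)_{j=1}^d$ span a dense subspace of $\mathscr H^L_+(H_B)\otimes\mathbb C^d$. 3. The image of $\mathcal R$ under $(\mathcal C^L)^*$ is $F^2_0(\mu_B)=\bigvee_{\alpha\neq\emptyset,\,h\in\mathcal H}L^\alpha\otimes h$. 4. If $F\in\mathscr H^L_+(H_B)$ is orthogonal to $\mathcal R$, then there is $f\in\mathcal H$ with $F(Z)=I_n\otimes f$ for all $n$ and all $Z\in\mathbb B^d_n$. -/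

import Mathlib

open scoped ComplexOrder Matrix

noncomputable section

namespace FreeHerglotz

/-- Words in the letters of `Fin d`, i.e. the free monoid on `d` letters; the product is `++`,
the empty word is `[]` and the transpose is `List.reverse`. -/
abbrev Word (d : ℕ) := List (Fin d)

/-- Level `n` of the non-commutative unit ball: strict row contractions
`Z = (Z_1, ..., Z_d)` of `n × n` matrices, i.e. `Z_1 Z_1^* + ... + Z_d Z_d^* < I`. -/
def Ball (d n : ℕ) :=
  {Z : Fin d → Matrix (Fin n) (Fin n) ℂ // (1 - ∑ j, Z j * (Z j)ᴴ).PosDef}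

/-- The monomial `Z^α = Z_{i_1} ⋯ Z_{i_k}` for `α = i_1 ⋯ i_k`. -/
def wordPow {d n : ℕ} (Z : Fin d → Matrix (Fin n) (Fin n) ℂ) (α : Word d) :
    Matrix (Fin n) (Fin n) ℂ := (α.map Z).prod

/-- The origin `0_n` of level `n`. -/
def Ball.origin (d n : ℕ) : Ball d n :=
  ⟨fun _ => 0, by simpa using Matrix.PosDef.one⟩

section Hardy

variable {d : ℕ} {H : Type*} [NormedAddCommGroup H] [InnerProductSpace ℂ H] [CompleteSpace H]

/-- The vector-valued full Fock space `F^2_d ⊗ H = ℓ^2(words; H)`, whose element `f` is identified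
with the free function `Z ↦ ∑_α Z^α ⊗ f_α`, an element of the free Hardy space. -/
abbrev Fock (d : ℕ) (H : Type*) [NormedAddCommGroup H] := lp (fun _ : Word d => H) 2

/-- The value `f(Z) = ∑_α Z^α ⊗ f_α`, an `n × n` matrix over `H`. -/
def hardyEval (f : Fock d H) {n : ℕ} (Z : Ball d n) : Matrix (Fin n) (Fin n) H :=
  Matrix.of fun i j => ∑' α : Word d, wordPow Z.1 α i j • f α

/-- `X ⊗ I_H` for a complex matrix `X`. -/
def ampl (H : Type*) [NormedAddCommGroup H] [InnerProductSpace ℂ H] {n m : ℕ}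
    (X : Matrix (Fin n) (Fin m) ℂ) : Matrix (Fin n) (Fin m) (H →L[ℂ] H) :=
  X.map fun z => z • (1 : H →L[ℂ] H)

/-- The action of an operator matrix on `ℂ^m ⊗ H`. -/
def act {n m : ℕ} (A : Matrix (Fin n) (Fin m) (H →L[ℂ] H)) (ξ : Fin m → H) : Fin n → H :=
  fun i => ∑ k, A i k (ξ k)

/-- The product of an operator matrix and a matrix over `H`. -/
def opMul {n m l : ℕ} (A : Matrix (Fin n) (Fin m) (H →L[ℂ] H)) (M : Matrix (Fin m) (Fin l) H) :
    Matrix (Fin n) (Fin l) H :=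
  Matrix.of fun i j => ∑ k, A i k (M k j)

/-- The operator-valued left free Schur class: free functions `B` on the non-commutative unit ball,
with values `B(Z)` in `ℂ^{n × n} ⊗ L(H)`, such that `f ↦ B f` is a contraction of the free Hardy
space `H^2 ⊗ H` into itself. -/
structure LeftSchur (d : ℕ) (H : Type*) [NormedAddCommGroup H] [InnerProductSpace ℂ H]
    [CompleteSpace H] where
  toFun : ∀ n : ℕ, Ball d n → Matrix (Fin n) (Fin n) (H →L[ℂ] H)
  intertwines : ∀ (n m : ℕ) (X : Matrix (Fin n) (Fin m) ℂ) (Z : Ball d n) (W : Ball d m),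
    (∀ j, Z.1 j * X = X * W.1 j) → toFun n Z * ampl H X = ampl H X * toFun m W
  contractive_multiplier : ∀ f : Fock d H, ∃ g : Fock d H, ‖g‖ ≤ ‖f‖ ∧
    ∀ (n : ℕ) (Z : Ball d n), opMul (toFun n Z) (hardyEval f Z) = hardyEval g Z

namespace LeftSchur

/-- The Cayley transform `H_B = (I + B)(I - B)⁻¹` is defined: `I - B(Z)` is invertible on the
ball. -/
def CayleyDefined (B : LeftSchur d H) : Prop :=
  ∀ (n : ℕ) (Z : Ball d n), IsUnit (1 - B.toFun n Z)

/-- The Herglotz function `H_B(Z) = (I + B(Z))(I - B(Z))⁻¹`. -/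
def herglotz (B : LeftSchur d H) (n : ℕ) (Z : Ball d n) : Matrix (Fin n) (Fin n) (H →L[ℂ] H) :=
  (1 + B.toFun n Z) * Ring.inverse (1 - B.toFun n Z)

end LeftSchur

/-- The free Szegő kernel `K(Z,W)[P] = ∑_α Z^α P (W^α)^*`. -/
def szego {n m : ℕ} (Z : Ball d n) (W : Ball d m) (P : Matrix (Fin n) (Fin m) ℂ) :
    Matrix (Fin n) (Fin m) ℂ :=
  Matrix.of fun i k => ∑' α : Word d, (wordPow Z.1 α * P * (wordPow W.1 α)ᴴ) i k

/-- The left free Herglotz kernel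
`K^{H_B}(Z,W)[P] = ½ (H_B(Z) (K(Z,W)[P] ⊗ I) + (K(Z,W)[P] ⊗ I) H_B(W)^*)`. -/
def LeftSchur.herglotzKernel (B : LeftSchur d H) {n m : ℕ} (Z : Ball d n) (W : Ball d m)
    (P : Matrix (Fin n) (Fin m) ℂ) : Matrix (Fin n) (Fin m) (H →L[ℂ] H) :=
  (2⁻¹ : ℂ) • (B.herglotz n Z * ampl H (szego Z W P) + ampl H (szego Z W P) * (B.herglotz m W)ᴴ)

/-- An index `(Z, y, v)` of a kernel vector `K{Z,y,v}`. -/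
structure Point (d : ℕ) where
  n : ℕ
  Z : Ball d n
  y : Fin n → ℂ
  v : Fin n → ℂ

/-- The Gram matrix of the kernel vectors: the entry at `(Z,y,v), (W,x,u)` is the operator
`(y ⊗ I)^* K^{H_B}(Z,W)[v u^*] (x ⊗ I)` on `H`. -/
def LeftSchur.gram (B : LeftSchur d H) : Matrix (Point d) (Point d) (H →L[ℂ] H) :=
  Matrix.of fun p q => ∑ i, ∑ k, (star (p.y i) * q.y k) •
    B.herglotzKernel p.Z q.Z (Matrix.vecMulVec p.v (star q.v)) i k

/-! Helper facts: square summability of the entries of `Z^α`. -/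

/-- Squared Euclidean norm on `ℂ^n`. -/
def nsq {n : ℕ} (x : Fin n → ℂ) : ℝ := ∑ i, ‖x i‖ ^ 2

theorem nsq_nonneg {n : ℕ} (x : Fin n → ℂ) : 0 ≤ nsq x :=
  Finset.sum_nonneg fun _ _ => by positivity

theorem wordPow_cons {n : ℕ} (Z : Fin d → Matrix (Fin n) (Fin n) ℂ) (j : Fin d) (α : Word d) :
    wordPow Z (j :: α) = Z j * wordPow Z α := by simp [wordPow]

theorem nsq_eq {n : ℕ} (x : Fin n → ℂ) : ((nsq x : ℝ) : ℂ) = star x ⬝ᵥ x := by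
  simp only [nsq, dotProduct, Pi.star_apply, RCLike.star_def]
  push_cast
  exact Finset.sum_congr rfl fun i _ => (RCLike.conj_mul (x i)).symm

theorem nsq_star {n : ℕ} (x : Fin n → ℂ) : nsq (star x) = nsq x := by simp [nsq]

theorem ball_quad {n : ℕ} (Z : Ball d n) (x : Fin n → ℂ) (hx : x ≠ 0) :
    ∑ j, nsq (Matrix.vecMul x (Z.1 j)) < nsq x := by
  have h := (Matrix.posDef_iff_dotProduct_mulVec.1 Z.2).2 (x := star x) (by simpa using hx)
  have key : star (star x) ⬝ᵥ ((1 - ∑ j, Z.1 j * (Z.1 j)ᴴ) *ᵥ star x) =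
      ((nsq x - ∑ j, nsq (Matrix.vecMul x (Z.1 j)) : ℝ) : ℂ) := by
    rw [Matrix.sub_mulVec, dotProduct_sub, Matrix.one_mulVec, star_star, Matrix.sum_mulVec,
      dotProduct_sum]
    push_cast
    congr 1
    · rw [nsq_eq, dotProduct_comm]
    · refine Finset.sum_congr rfl fun j _ => ?_
      rw [nsq_eq, ← Matrix.mulVec_mulVec, Matrix.dotProduct_mulVec, ← Matrix.star_vecMul,
        dotProduct_comm]
  rw [key] at h
  have h' : (0 : ℝ) < nsq x - ∑ j, nsq (Matrix.vecMul x (Z.1 j)) := by exact_mod_cast h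
  linarith

theorem ball_step {n : ℕ} (Z : Ball d n) : ∃ ε : ℝ, 0 < ε ∧ ∀ x : Fin n → ℂ,
    ε * nsq x + ∑ j, nsq (Matrix.vecMul x (Z.1 j)) ≤ nsq x := by
  let φ : (Fin n → ℂ) → ℝ := fun x => nsq x - ∑ j, nsq (Matrix.vecMul x (Z.1 j))
  have hφc : Continuous φ := by
    have h1 : Continuous fun x : Fin n → ℂ => nsq x := by unfold nsq; fun_prop
    have h2 : ∀ j, Continuous fun x : Fin n → ℂ => Matrix.vecMul x (Z.1 j) := fun j => by
      unfold Matrix.vecMul dotProduct; fun_prop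
    exact h1.sub (continuous_finsetSum _ fun j _ => h1.comp (h2 j))
  have hsm : ∀ (c : ℝ) (x : Fin n → ℂ), nsq ((c : ℂ) • x) = c ^ 2 * nsq x := by
    intro c x
    simp [nsq, Finset.mul_sum, mul_pow]
  have hφs : ∀ (c : ℝ) (x : Fin n → ℂ), φ ((c : ℂ) • x) = c ^ 2 * φ x := by
    intro c x
    simp only [φ, Matrix.smul_vecMul, hsm, mul_sub, Finset.mul_sum]
  have hn : ∀ x : Fin n → ℂ, nsq x ≤ n * ‖x‖ ^ 2 := by
    intro x
    calc nsq x ≤ ∑ _i : Fin n, ‖x‖ ^ 2 := Finset.sum_le_sum fun i _ => by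
          gcongr; exact norm_le_pi_norm x i
      _ = n * ‖x‖ ^ 2 := by simp
  rcases (Metric.sphere (0 : Fin n → ℂ) 1).eq_empty_or_nonempty with he | hne
  · refine ⟨1, one_pos, fun x => ?_⟩
    have hx : x = 0 := by
      by_contra hx
      have : ((‖x‖⁻¹ : ℝ) : ℂ) • x ∈ Metric.sphere (0 : Fin n → ℂ) 1 := by
        simp [norm_smul, hx]
      rw [he] at this
      exact this
    subst hx
    simp [nsq]
  · obtain ⟨x0, hx0, hmin⟩ := (isCompact_sphere (0 : Fin n → ℂ) 1).exists_isMinOn hne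
      hφc.continuousOn
    have hx0' : x0 ≠ 0 := by
      rintro rfl
      simp at hx0
    have hm : 0 < φ x0 := sub_pos.2 (ball_quad Z x0 hx0')
    have hlow : ∀ x, φ x0 * ‖x‖ ^ 2 ≤ φ x := by
      intro x
      by_cases hx : x = 0
      · subst hx; simp [φ, nsq]
      have hx1 : ((‖x‖⁻¹ : ℝ) : ℂ) • x ∈ Metric.sphere (0 : Fin n → ℂ) 1 := by
        simp [norm_smul, hx]
      have h2 : φ x0 ≤ φ (((‖x‖⁻¹ : ℝ) : ℂ) • x) := hmin hx1
      rw [hφs] at h2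
      have h3 : 0 < ‖x‖ := norm_pos_iff.2 hx
      calc φ x0 * ‖x‖ ^ 2 ≤ (‖x‖⁻¹ ^ 2 * φ x) * ‖x‖ ^ 2 := by gcongr
        _ = φ x := by field_simp
    refine ⟨φ x0 / (n + 1), by positivity, fun x => ?_⟩
    have h4 : φ x0 / (n + 1) * nsq x ≤ φ x := by
      refine le_trans ?_ (hlow x)
      calc φ x0 / (n + 1) * nsq x ≤ φ x0 / (n + 1) * ((n + 1) * ‖x‖ ^ 2) := by
            gcongr
            refine (hn x).trans ?_
            gcongr
            linarith
        _ = φ x0 * ‖x‖ ^ 2 := by field_simp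
    simp only [φ] at h4 ⊢
    linarith

/-- The finite set of words of length less than `N`. -/
def shortWords (d : ℕ) : ℕ → Finset (Word d)
  | 0 => ∅
  | N + 1 => insert [] ((Finset.univ ×ˢ shortWords d N).image fun p : Fin d × Word d => p.1 :: p.2)

theorem mem_shortWords : ∀ (N : ℕ) (α : Word d), α.length < N → α ∈ shortWords d N
  | 0, _, h => absurd h (Nat.not_lt_zero _)
  | N + 1, [], _ => by simp [shortWords]
  | N + 1, j :: α, h => by
    have := mem_shortWords N α (by simpa using h)
    simp [shortWords, this]

theorem shortWords_bound {n : ℕ} (Z : Ball d n) {ε : ℝ} (h : ∀ x : Fin n → ℂ,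
    ε * nsq x + ∑ j, nsq (Matrix.vecMul x (Z.1 j)) ≤ nsq x) : ∀ (N : ℕ) (x : Fin n → ℂ),
    ε * ∑ α ∈ shortWords d N, nsq (Matrix.vecMul x (wordPow Z.1 α)) ≤ nsq x
  | 0, x => by simpa [shortWords] using nsq_nonneg x
  | N + 1, x => by
    rw [shortWords, Finset.sum_insert (by simp), Finset.sum_image (by
      rintro ⟨i, a⟩ _ ⟨j, b⟩ _ hab
      simpa using hab), Finset.sum_product, mul_add, Finset.mul_sum]
    refine le_trans (add_le_add ?_ (Finset.sum_le_sum fun j _ => ?_)) (h x)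
    · simp [wordPow]
    · have := shortWords_bound Z h N (Matrix.vecMul x (Z.1 j))
      simpa [wordPow_cons, Matrix.vecMul_vecMul] using this

theorem summable_entry {n : ℕ} (Z : Ball d n) (i k : Fin n) :
    Summable fun α : Word d => ‖wordPow Z.1 α i k‖ ^ 2 := by
  obtain ⟨ε, hε, h⟩ := ball_step Z
  refine summable_of_sum_le (c := nsq (Pi.single i (1 : ℂ) : Fin n → ℂ) / ε)
    (fun _ => by positivity) fun s => ?_
  have hs : s ⊆ shortWords d (s.sup List.length + 1) := fun α hα =>
    mem_shortWords _ _ (Nat.lt_succ_of_le (Finset.le_sup (f := List.length) hα))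
  rw [le_div_iff₀ hε, mul_comm]
  refine le_trans ?_ (shortWords_bound Z h (s.sup List.length + 1) (Pi.single i 1))
  gcongr
  refine (Finset.sum_le_sum fun α _ => ?_).trans
    (Finset.sum_le_sum_of_subset_of_nonneg hs fun _ _ _ => nsq_nonneg _)
  have : Matrix.vecMul (Pi.single i (1 : ℂ)) (wordPow Z.1 α) k = wordPow Z.1 α i k := by
    simp
  rw [← this]
  exact Finset.single_le_sum (f := fun k => ‖Matrix.vecMul (Pi.single i (1 : ℂ))
    (wordPow Z.1 α) k‖ ^ 2) (fun _ _ => by positivity) (Finset.mem_univ k)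

set_option linter.unusedSectionVars false

/-! Helper facts: positivity of the Herglotz kernel. -/

open scoped InnerProductSpace

/-- Standard inner product on `ℂ^n ⊗ H`. -/
def dotH {n : ℕ} (ξ η : Fin n → H) : ℂ := ∑ i, ⟪ξ i, η i⟫_ℂ

theorem act_mul {n m l : ℕ} (A : Matrix (Fin n) (Fin m) (H →L[ℂ] H))
    (C : Matrix (Fin m) (Fin l) (H →L[ℂ] H)) (ξ : Fin l → H) :
    act (A * C) ξ = act A (act C ξ) := by
  funext i
  simp only [act, Matrix.mul_apply, map_sum, sum_apply]
  rw [Finset.sum_comm]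
  rfl

theorem dotH_act {n m : ℕ} (A : Matrix (Fin n) (Fin m) (H →L[ℂ] H)) (ξ : Fin n → H)
    (η : Fin m → H) : dotH ξ (act A η) = dotH (act Aᴴ ξ) η := by
  simp only [dotH, act, inner_sum, sum_inner, Matrix.conjTranspose_apply,
    ContinuousLinearMap.star_eq_adjoint, ContinuousLinearMap.adjoint_inner_left]
  exact Finset.sum_comm

theorem act_sub {n m : ℕ} (A C : Matrix (Fin n) (Fin m) (H →L[ℂ] H)) (ξ : Fin m → H) :
    act (A - C) ξ = act A ξ - act C ξ := by
  funext i
  simp [act]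

theorem dotH_sub {n : ℕ} (ξ η η' : Fin n → H) :
    dotH ξ (η - η') = dotH ξ η - dotH ξ η' := by
  simp [dotH]

theorem memℓp_kvec {n : ℕ} (Z : Ball d n) (v : Fin n → ℂ) (ξ : Fin n → H) :
    Memℓp (fun α : Word d => ∑ i, star ((wordPow Z.1 α *ᵥ v) i) • ξ i) 2 := by
  have h0 : ∀ i j, Memℓp (fun α : Word d => star (wordPow Z.1 α i j) • (star (v j) • ξ i)) 2 := by
    intro i j
    refine memℓp_gen ?_
    have := (summable_entry Z i j).mul_right (‖star (v j) • ξ i‖ ^ 2)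
    simpa [norm_smul, mul_pow] using this
  have h1 : (fun α : Word d => ∑ i, star ((wordPow Z.1 α *ᵥ v) i) • ξ i) =
      ∑ i, ∑ j, fun α : Word d => star (wordPow Z.1 α i j) • (star (v j) • ξ i) := by
    funext α
    simp [Finset.sum_apply, Matrix.mulVec, dotProduct, Finset.sum_smul, mul_smul]
  rw [h1]
  have h2 : ∀ i, Memℓp (∑ j, fun α : Word d => star (wordPow Z.1 α i j) • (star (v j) • ξ i)) 2 := by
    intro i
    have := Memℓp.finsetSum Finset.univ fun j _ => h0 i j
    convert this using 1
    funext α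
    simp
  have := Memℓp.finsetSum Finset.univ fun i _ => h2 i
  convert this using 1
  funext α
  simp

/-- The kernel vector of the free Hardy space at `Z`, `v` and `ξ ∈ ℂ^n ⊗ H`. -/
def kvec {n : ℕ} (Z : Ball d n) (v : Fin n → ℂ) (ξ : Fin n → H) : Fock d H :=
  ⟨fun α => ∑ i, star ((wordPow Z.1 α *ᵥ v) i) • ξ i, memℓp_kvec Z v ξ⟩

theorem kvec_apply {n : ℕ} (Z : Ball d n) (v : Fin n → ℂ) (ξ : Fin n → H) (α : Word d) :
    kvec Z v ξ α = ∑ i, star ((wordPow Z.1 α *ᵥ v) i) • ξ i := rfl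

/-- The vector `M v` in `ℂ^n ⊗ H`, for a matrix `M` over `H`. -/
def mulV {n : ℕ} (M : Matrix (Fin n) (Fin n) H) (v : Fin n → ℂ) : Fin n → H :=
  fun i => ∑ j, v j • M i j

theorem act_mulV {n : ℕ} (A : Matrix (Fin n) (Fin n) (H →L[ℂ] H)) (M : Matrix (Fin n) (Fin n) H)
    (v : Fin n → ℂ) : act A (mulV M v) = mulV (opMul A M) v := by
  funext i
  simp only [act, mulV, opMul, map_sum, map_smul, Matrix.of_apply, Finset.smul_sum]
  exact Finset.sum_comm

theorem kvec_single {n : ℕ} (Z : Ball d n) (i j : Fin n) (h : H) (α : Word d) :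
    kvec Z (Pi.single j 1) (Pi.single i h) α = star (wordPow Z.1 α i j) • h := by
  rw [kvec_apply, Finset.sum_eq_single i]
  · simp
  · intro b _ hb
    simp [hb]
  · simp

theorem summable_entry_smul {n : ℕ} (f : Fock d H) (Z : Ball d n) (i j : Fin n) :
    Summable fun α : Word d => wordPow Z.1 α i j • f α := by
  have h1 : Summable fun α : Word d => ‖f α‖ ^ 2 := by
    have := (lp.memℓp f).summable (by norm_num)
    simpa using this
  refine Summable.of_norm_bounded ((summable_entry Z i j).add h1) fun α => ?_
  rw [norm_smul]
  nlinarith [sq_nonneg (‖wordPow Z.1 α i j‖ - ‖f α‖), sq_nonneg (‖wordPow Z.1 α i j‖),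
    sq_nonneg ‖f α‖]

theorem hasSum_kvec_inner {n : ℕ} (Z : Ball d n) (v : Fin n → ℂ) (ξ : Fin n → H) (f : Fock d H) :
    ⟪kvec Z v ξ, f⟫_ℂ = dotH ξ (mulV (hardyEval f Z) v) := by
  rw [lp.inner_eq_tsum]
  have hs : ∀ i j, HasSum (fun α : Word d => v j * ⟪ξ i, wordPow Z.1 α i j • f α⟫_ℂ)
      (v j * ⟪ξ i, hardyEval f Z i j⟫_ℂ) := fun i j =>
    (((innerSL ℂ (ξ i)).hasSum (summable_entry_smul f Z i j).hasSum)).mul_left _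
  have h2 := hasSum_sum fun i (_ : i ∈ Finset.univ) => hasSum_sum fun j (_ : j ∈ Finset.univ) =>
    hs i j
  have h3 : (fun α : Word d => ⟪kvec Z v ξ α, f α⟫_ℂ) =
      fun α => ∑ i, ∑ j, v j * ⟪ξ i, wordPow Z.1 α i j • f α⟫_ℂ := by
    funext α
    rw [kvec_apply, sum_inner]
    refine Finset.sum_congr rfl fun i _ => ?_
    simp only [inner_smul_left, inner_smul_right, Matrix.mulVec, dotProduct, RCLike.star_def,
      RingHomCompTriple.comp_apply, RingHom.id_apply, Finset.sum_mul]
    exact Finset.sum_congr rfl fun j _ => by ring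
  rw [h3, h2.tsum_eq]
  simp only [dotH, mulV, inner_sum, inner_smul_right]

theorem hasSum_szego {n m : ℕ} (Z : Ball d n) (W : Ball d m) (v : Fin n → ℂ) (u : Fin m → ℂ)
    (i : Fin n) (k : Fin m) :
    HasSum (fun α : Word d => (wordPow Z.1 α *ᵥ v) i * star ((wordPow W.1 α *ᵥ u) k))
      (szego Z W (Matrix.vecMulVec v (star u)) i k) := by
  have hs : Summable fun α : Word d =>
      (wordPow Z.1 α *ᵥ v) i * star ((wordPow W.1 α *ᵥ u) k) := by
    have := lp.summable_inner (𝕜 := ℂ) (kvec (H := ℂ) Z v (Pi.single i 1))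
      (kvec (H := ℂ) W u (Pi.single k 1))
    refine this.congr fun α => ?_
    have e1 : ∀ {n : ℕ} (Z : Ball d n) (v : Fin n → ℂ) (i : Fin n),
        kvec (H := ℂ) Z v (Pi.single i 1) α = star ((wordPow Z.1 α *ᵥ v) i) := by
      intro n Z v i
      rw [kvec_apply, Finset.sum_eq_single i]
      · simp
      · intro b _ hb
        simp [hb]
      · simp
    rw [e1, e1]
    simp [mul_comm]
  convert hs.hasSum using 1
  simp only [szego, Matrix.of_apply]
  refine tsum_congr fun α => ?_
  rw [Matrix.mul_vecMulVec, Matrix.vecMulVec_mul, Matrix.vecMulVec_apply, ← Matrix.star_mulVec]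
  rfl

theorem inner_kvec {n m : ℕ} (Z : Ball d n) (W : Ball d m) (v : Fin n → ℂ) (u : Fin m → ℂ)
    (ξ : Fin n → H) (η : Fin m → H) : ⟪kvec Z v ξ, kvec W u η⟫_ℂ =
      dotH ξ (act (ampl H (szego Z W (Matrix.vecMulVec v (star u)))) η) := by
  rw [lp.inner_eq_tsum]
  have h2 := hasSum_sum fun i (_ : i ∈ Finset.univ) => hasSum_sum fun k (_ : k ∈ Finset.univ) =>
    (hasSum_szego Z W v u i k).mul_right ⟪ξ i, η k⟫_ℂ
  have h3 : (fun α : Word d => ⟪kvec Z v ξ α, kvec W u η α⟫_ℂ) = fun α => ∑ i, ∑ k,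
      (wordPow Z.1 α *ᵥ v) i * star ((wordPow W.1 α *ᵥ u) k) * ⟪ξ i, η k⟫_ℂ := by
    funext α
    rw [kvec_apply, kvec_apply, sum_inner]
    refine Finset.sum_congr rfl fun i _ => ?_
    rw [inner_sum]
    refine Finset.sum_congr rfl fun k _ => ?_
    simp only [inner_smul_left, inner_smul_right, RCLike.star_def, RingHomCompTriple.comp_apply,
      RingHom.id_apply]
    ring
  rw [h3, h2.tsum_eq]
  simp only [dotH, act, ampl, inner_sum, Matrix.map_apply, smul_apply,
    one_apply_eq_self, inner_smul_right]

theorem herglotzKernel_eq (B : LeftSchur d H) (hB : B.CayleyDefined) {n m : ℕ} (Z : Ball d n)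
    (W : Ball d m) (P : Matrix (Fin n) (Fin m) ℂ) : B.herglotzKernel Z W P =
      Ring.inverse (1 - B.toFun n Z) * (ampl H (szego Z W P) -
        B.toFun n Z * ampl H (szego Z W P) * (B.toFun m W)ᴴ) *
        (Ring.inverse (1 - B.toFun m W))ᴴ := by
  unfold LeftSchur.herglotzKernel LeftSchur.herglotz
  generalize ampl H (szego Z W P) = S
  have hz := hB n Z
  have hw := hB m W
  generalize B.toFun n Z = b at *
  generalize B.toFun m W = c at *
  have z1 : Ring.inverse (1 - b) * (1 - b) = 1 := Ring.inverse_mul_cancel _ hz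
  have w1 : Ring.inverse (1 - c) * (1 - c) = 1 := Ring.inverse_mul_cancel _ hw
  have z2 : (1 + b) * Ring.inverse (1 - b) = Ring.inverse (1 - b) * (1 + b) := by
    have h1 : 1 + b = 2 - (1 - b) := by
      rw [← one_add_one_eq_two]; abel
    rw [h1, sub_mul, mul_sub, Ring.inverse_mul_cancel _ hz, Ring.mul_inverse_cancel _ hz]
    congr 1
    rw [two_mul, mul_two]
  have w2 : (1 + c) * Ring.inverse (1 - c) = Ring.inverse (1 - c) * (1 + c) := by
    have h1 : 1 + c = 2 - (1 - c) := by
      rw [← one_add_one_eq_two]; abel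
    rw [h1, sub_mul, mul_sub, Ring.inverse_mul_cancel _ hw, Ring.mul_inverse_cancel _ hw]
    congr 1
    rw [two_mul, mul_two]
  generalize Ring.inverse (1 - b) = g at *
  generalize Ring.inverse (1 - c) = k at *
  have w3 : (1 - c)ᴴ * kᴴ = 1 := by
    rw [← Matrix.conjTranspose_mul, w1, Matrix.conjTranspose_one]
  have e1 : (1 + b) * g * S = g * ((1 + b) * S * (1 - c)ᴴ) * kᴴ := by
    simp only [Matrix.mul_assoc]
    rw [w3, Matrix.mul_one, ← Matrix.mul_assoc, z2, Matrix.mul_assoc]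
  have e2 : S * ((1 + c) * k)ᴴ = g * ((1 - b) * S * (1 + c)ᴴ) * kᴴ := by
    rw [w2, Matrix.conjTranspose_mul]
    simp only [← Matrix.mul_assoc]
    rw [z1, Matrix.one_mul]
  rw [e1, e2, ← Matrix.add_mul, ← Matrix.mul_add]
  have e3 : (1 + b) * S * (1 - c)ᴴ + (1 - b) * S * (1 + c)ᴴ = (2 : ℂ) • (S - b * S * cᴴ) := by
    simp only [Matrix.conjTranspose_sub, Matrix.conjTranspose_add, Matrix.conjTranspose_one,
      Matrix.add_mul, Matrix.sub_mul, Matrix.mul_add, Matrix.mul_sub, Matrix.one_mul,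
      Matrix.mul_one, Matrix.mul_assoc]
    module
  rw [e3, Matrix.mul_smul, Matrix.smul_mul, smul_smul]
  norm_num

theorem dotH_gram (B : LeftSchur d H) (p q : Point d) (h g : H) : ⟪h, B.gram p q g⟫_ℂ =
    dotH (fun i => p.y i • h)
      (act (B.herglotzKernel p.Z q.Z (Matrix.vecMulVec p.v (star q.v))) fun k => q.y k • g) := by
  simp only [LeftSchur.gram, Matrix.of_apply, dotH, act, inner_sum, sum_apply, smul_apply,
    inner_smul_left, inner_smul_right, map_smul, RCLike.star_def]
  refine Finset.sum_congr rfl fun i _ => Finset.sum_congr rfl fun k _ => ?_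
  ring

/-- The vector `(I - B(Z)^*)⁻¹ (y ⊗ h)`. -/
def LeftSchur.xi (B : LeftSchur d H) (p : Point d) (h : H) : Fin p.n → H :=
  act (Ring.inverse (1 - B.toFun p.n p.Z))ᴴ fun i => p.y i • h

theorem gram_eq (B : LeftSchur d H) (hB : B.CayleyDefined) (p q : Point d) (h g : H) :
    ⟪h, B.gram p q g⟫_ℂ =
      ⟪kvec p.Z p.v (B.xi p h), kvec q.Z q.v (B.xi q g)⟫_ℂ -
      ⟪kvec p.Z p.v (act (B.toFun p.n p.Z)ᴴ (B.xi p h)),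
        kvec q.Z q.v (act (B.toFun q.n q.Z)ᴴ (B.xi q g))⟫_ℂ := by
  rw [dotH_gram, herglotzKernel_eq B hB, inner_kvec, inner_kvec, act_mul, act_mul, dotH_act,
    act_sub, dotH_sub]
  congr 1
  rw [act_mul, act_mul, dotH_act]
  rfl

theorem posSemidef_of_gram {X V E : Type*} [NormedAddCommGroup V] [InnerProductSpace ℂ V]
    [CompleteSpace V] [NormedAddCommGroup E] [InnerProductSpace ℂ E] {K : Matrix X X (V →L[ℂ] V)}
    (a b : X → V → E)
    (hK : ∀ p q h g, ⟪h, K p q g⟫_ℂ = ⟪a p h, a q g⟫_ℂ - ⟪b p h, b q g⟫_ℂ)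
    (hab : ∀ s : X →₀ V, ‖s.sum b‖ ≤ ‖s.sum a‖) : K.PosSemidef := by
  have htfae := (RKHS.posSemidef_tfae (𝕜 := ℂ) (K := K)).out 0 2
  refine htfae.2 ⟨?_, fun s => ?_⟩
  · ext p q : 1
    refine ContinuousLinearMap.ext fun g => ext_inner_left ℂ fun h => ?_
    rw [Matrix.conjTranspose_apply, ContinuousLinearMap.star_eq_adjoint,
      ContinuousLinearMap.adjoint_inner_right, ← inner_conj_symm, hK, hK, map_sub,
      inner_conj_symm, inner_conj_symm]
  · have e : (s.sum fun x w => s.sum fun x' w' => ⟪K x' x w, w'⟫_ℂ) =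
        ⟪s.sum a, s.sum a⟫_ℂ - ⟪s.sum b, s.sum b⟫_ℂ := by
      simp only [Finsupp.sum, sum_inner, inner_sum, ← Finset.sum_sub_distrib]
      rw [Finset.sum_comm]
      refine Finset.sum_congr rfl fun x _ => Finset.sum_congr rfl fun x' _ => ?_
      rw [← inner_conj_symm, hK, map_sub, inner_conj_symm, inner_conj_symm]
    rw [e, map_sub, inner_self_eq_norm_sq, inner_self_eq_norm_sq]
    have := hab s
    have h0 := norm_nonneg (s.sum b)
    nlinarith

theorem gram_posSemidef (B : LeftSchur d H) (hB : B.CayleyDefined) : B.gram.PosSemidef := by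
  refine posSemidef_of_gram (fun p h => kvec p.Z p.v (B.xi p h))
    (fun p h => kvec p.Z p.v (act (B.toFun p.n p.Z)ᴴ (B.xi p h))) (gram_eq B hB) fun s => ?_
  generalize hb : s.sum (fun p h => kvec p.Z p.v (act (B.toFun p.n p.Z)ᴴ (B.xi p h))) = f
  generalize ha : s.sum (fun p h => kvec p.Z p.v (B.xi p h)) = e
  obtain ⟨g, hg, hfg⟩ := B.contractive_multiplier f
  have key : ⟪f, f⟫_ℂ = ⟪e, g⟫_ℂ := by
    have h0 : ⟪f, f⟫_ℂ =
        ⟪s.sum (fun p h => kvec p.Z p.v (act (B.toFun p.n p.Z)ᴴ (B.xi p h))), f⟫_ℂ := by rw [hb]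
    rw [h0, ← ha, Finsupp.sum, Finsupp.sum, sum_inner, sum_inner]
    refine Finset.sum_congr rfl fun p _ => ?_
    rw [hasSum_kvec_inner, hasSum_kvec_inner, ← dotH_act, act_mulV, hfg]
  have h1 : ‖f‖ ^ 2 ≤ ‖e‖ * ‖g‖ := by
    rw [← inner_self_eq_norm_sq (𝕜 := ℂ), key]
    exact re_inner_le_norm e g
  by_contra hlt
  push Not at hlt
  have := norm_nonneg e
  have := norm_nonneg g
  nlinarith

/-! Taylor-Taylor coefficients at the origin. -/

/-- The jointly nilpotent `d`-tuple of bidiagonal matrices of size `|α| + 1` attached to the word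
`α = i_1 ⋯ i_k`: the superdiagonal entry in row `l` (counted from `0`) of the `j`-th matrix is `1/2`
if `i_{l+1} = j`, and all other entries vanish. -/
def bidiagonal (α : Word d) (j : Fin d) : Matrix (Fin (α.length + 1)) (Fin (α.length + 1)) ℂ :=
  Matrix.of fun i k => if (k : ℕ) = i + 1 ∧ α[(i : ℕ)]? = some j then 2⁻¹ else 0

theorem bidiagonal_mem (α : Word d) :
    (1 - ∑ j, bidiagonal α j * (bidiagonal α j)ᴴ).PosDef := by
  have : (1 - ∑ j, bidiagonal α j * (bidiagonal α j)ᴴ) =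
      Matrix.diagonal fun i : Fin (α.length + 1) =>
        if (i : ℕ) < α.length then (3 / 4 : ℂ) else 1 := by
    ext i k
    simp only [Matrix.sub_apply, Matrix.sum_apply, Matrix.mul_apply, Matrix.conjTranspose_apply,
      bidiagonal, Matrix.of_apply, Matrix.diagonal_apply, Matrix.one_apply]
    by_cases hi : (i : ℕ) < α.length
    · have e1 : ∀ j, (∑ l : Fin (α.length + 1),
          (if (l : ℕ) = i + 1 ∧ α[(i : ℕ)]? = some j then (2⁻¹ : ℂ) else 0) *
            star (if (l : ℕ) = k + 1 ∧ α[(k : ℕ)]? = some j then (2⁻¹ : ℂ) else 0)) =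
          if α[(i : ℕ)] = j then (if i = k then (4⁻¹ : ℂ) else 0) else 0 := by
        intro j
        rw [Finset.sum_eq_single (⟨i + 1, by omega⟩ : Fin (α.length + 1))]
        · by_cases hik : i = k
          · subst hik
            simp only [List.getElem?_eq_getElem hi, Option.some.injEq, true_and, if_true]
            split_ifs <;> norm_num
          · have hne : ¬ ((i : ℕ) = k) := fun h => hik (Fin.ext h)
            simp [hik, hne]
        · intro l _ hl
          have : ¬ ((l : ℕ) = i + 1) := fun h => hl (Fin.ext h)
          simp [this]
        · simp
      simp only [e1, hi, if_true]
      rw [Finset.sum_ite_eq]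
      by_cases hik : i = k <;> simp [hik]
      norm_num
    · simp [hi]
  rw [this, Matrix.posDef_diagonal_iff]
  intro i
  split_ifs <;> norm_num [Complex.lt_def]

/-- The bidiagonal tuple as a point of the ball. -/
def shiftPoint (α : Word d) : Ball d (α.length + 1) := ⟨bidiagonal α, bidiagonal_mem α⟩

/-- The coefficient `F_α` of the Taylor-Taylor series `F(Z) = ∑_α Z^α ⊗ F_α` of a free function at
the origin, i.e. the value at `(e_{i_1}, ..., e_{i_k})` of its `k`-th order difference-differential
operator at `0`: by definition this is the upper right entry of `F` at a bidiagonal point (the factor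
`2 ^ k` undoes the scaling that keeps the point inside the ball). -/
def taylorCoeff {E : Type*} [AddCommGroup E] [Module ℂ E]
    (F : ∀ n : ℕ, Ball d n → Matrix (Fin n) (Fin n) E) (α : Word d) : E :=
  (2 : ℂ) ^ α.length • F (α.length + 1) (shiftPoint α) 0 (Fin.last _)

theorem wordPow_bidiagonal (α : Word d) : ∀ (γ : Word d) (i k : Fin (α.length + 1)),
    wordPow (bidiagonal α) γ i k =
      if (k : ℕ) = i + γ.length ∧ γ <+: α.drop i then (2⁻¹ : ℂ) ^ γ.length else 0
  | [], i, k => by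
    have : i = k ↔ (k : ℕ) = i := ⟨fun h => by rw [h], fun h => Fin.ext h.symm⟩
    simp [wordPow, Matrix.one_apply, this]
  | j :: γ, i, k => by
    rw [wordPow_cons, Matrix.mul_apply]
    by_cases hi : (i : ℕ) < α.length
    · rw [Finset.sum_eq_single (⟨i + 1, by omega⟩ : Fin (α.length + 1))]
      · rw [wordPow_bidiagonal α γ]
        have hd : α.drop i = α[(i : ℕ)] :: α.drop (i + 1) := List.drop_eq_getElem_cons hi
        simp only [bidiagonal, Matrix.of_apply, List.getElem?_eq_getElem hi, Option.some.injEq,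
          true_and, hd, List.cons_prefix_cons, List.length_cons]
        by_cases h1 : α[(i : ℕ)] = j
        · have h2 : (k : ℕ) = i + 1 + γ.length ↔ (k : ℕ) = i + (γ.length + 1) := by omega
          simp only [h1, h2, if_true, true_and]
          split_ifs
          · rw [pow_succ, mul_comm]
          · simp
        · have h1' : ¬ j = α[(i : ℕ)] := fun h => h1 h.symm
          simp [h1, h1']
      · intro l _ hl
        have : ¬ ((l : ℕ) = i + 1) := fun h => hl (Fin.ext h)
        simp [bidiagonal, this]
      · simp
    · have h1 : α[(i : ℕ)]? = none := List.getElem?_eq_none (by omega)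
      have h2 : α.drop i = [] := List.drop_eq_nil_of_le (by omega)
      simp [bidiagonal, h1, h2]

/-- Taylor-Taylor coefficients are unique: any expansion of `F` on the ball has the coefficients
`taylorCoeff F`. -/
theorem taylorCoeff_unique {E : Type*} [AddCommGroup E] [Module ℂ E] [TopologicalSpace E] [T2Space E]
    (F : ∀ n : ℕ, Ball d n → Matrix (Fin n) (Fin n) E) (c : Word d → E)
    (h : ∀ (n : ℕ) (Z : Ball d n) (i j : Fin n),
      HasSum (fun α => wordPow Z.1 α i j • c α) (F n Z i j)) (α : Word d) :
    taylorCoeff F α = c α := by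
  have h1 := h _ (shiftPoint α) 0 (Fin.last _)
  have h2 : HasSum (fun γ => wordPow (shiftPoint α).1 γ 0 (Fin.last _) • c γ)
      (wordPow (shiftPoint α).1 α 0 (Fin.last _) • c α) := by
    refine hasSum_single _ fun γ hγ => ?_
    rw [shiftPoint, wordPow_bidiagonal, if_neg, zero_smul]
    rintro ⟨hl, hp⟩
    exact hγ (hp.eq_of_length (by simpa using hl.symm))
  rw [taylorCoeff, h1.unique h2, shiftPoint, wordPow_bidiagonal, if_pos (by simp), smul_smul,
    ← mul_pow]
  norm_num

theorem ampl_mul_entry {n m l : ℕ} (X : Matrix (Fin n) (Fin m) ℂ)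
    (A : Matrix (Fin m) (Fin l) (H →L[ℂ] H)) (i : Fin n) (k : Fin l) :
    (ampl H X * A) i k = ∑ j, X i j • A j k := by
  simp [Matrix.mul_apply, ampl]

theorem mul_ampl_entry {n m l : ℕ} (A : Matrix (Fin n) (Fin m) (H →L[ℂ] H))
    (X : Matrix (Fin m) (Fin l) ℂ) (i : Fin n) (k : Fin l) :
    (A * ampl H X) i k = ∑ j, X j k • A i j := by
  simp [Matrix.mul_apply, ampl]

theorem herglotz_intertwines (B : LeftSchur d H) (hB : B.CayleyDefined) (n m : ℕ)
    (X : Matrix (Fin n) (Fin m) ℂ) (Z : Ball d n) (W : Ball d m)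
    (h : ∀ j, Z.1 j * X = X * W.1 j) :
    B.herglotz n Z * ampl H X = ampl H X * B.herglotz m W := by
  have hX := B.intertwines n m X Z W h
  have hz := hB n Z
  have hw := hB m W
  unfold LeftSchur.herglotz
  generalize B.toFun n Z = b at *
  generalize B.toFun m W = c at *
  generalize ampl H X = x at *
  have z1 : Ring.inverse (1 - b) * (1 - b) = 1 := Ring.inverse_mul_cancel _ hz
  have w1 : (1 - c) * Ring.inverse (1 - c) = 1 := Ring.mul_inverse_cancel _ hw
  have e : Ring.inverse (1 - b) * x = x * Ring.inverse (1 - c) := by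
    calc Ring.inverse (1 - b) * x
        = Ring.inverse (1 - b) * (x * ((1 - c) * Ring.inverse (1 - c))) := by
          rw [w1, Matrix.mul_one]
      _ = Ring.inverse (1 - b) * ((x * (1 - c)) * Ring.inverse (1 - c)) := by
          rw [Matrix.mul_assoc]
      _ = Ring.inverse (1 - b) * (((1 - b) * x) * Ring.inverse (1 - c)) := by
          rw [Matrix.mul_sub x, Matrix.sub_mul 1 b x, hX, Matrix.mul_one, Matrix.one_mul]
      _ = (Ring.inverse (1 - b) * (1 - b)) * (x * Ring.inverse (1 - c)) := by
          simp only [Matrix.mul_assoc]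
      _ = x * Ring.inverse (1 - c) := by rw [z1, Matrix.one_mul]
  rw [Matrix.mul_assoc, e, ← Matrix.mul_assoc, ← Matrix.mul_assoc, Matrix.add_mul,
    Matrix.mul_add, hX, Matrix.one_mul, Matrix.mul_one]

/-- The Taylor-Taylor coefficient `H_α` of `H_B`. -/
def LeftSchur.herglotzCoeff (B : LeftSchur d H) (α : Word d) : H →L[ℂ] H :=
  taylorCoeff B.herglotz α

theorem herglotz_shift_entry (B : LeftSchur d H) (hB : B.CayleyDefined) (α : Word d)
    (i : Fin (α.length + 1)) : B.herglotz _ (shiftPoint α) 0 i =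
      (2⁻¹ : ℂ) ^ (i : ℕ) • B.herglotzCoeff (α.take i) := by
  have hlen : (α.take i).length = i := by simp; omega
  have hle : (α.take i).length + 1 ≤ α.length + 1 := by omega
  let X : Matrix (Fin (α.length + 1)) (Fin ((α.take i).length + 1)) ℂ :=
    Matrix.of fun a b => if (a : ℕ) = b then 1 else 0
  have hX : ∀ j, (shiftPoint α).1 j * X = X * (shiftPoint (α.take i)).1 j := by
    intro j
    ext a b
    rw [Matrix.mul_apply, Matrix.mul_apply, Finset.sum_eq_single (Fin.castLE hle b)]
    · simp only [X, Matrix.of_apply, Fin.val_castLE, if_true, mul_one, shiftPoint, bidiagonal]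
      by_cases ha : (a : ℕ) < (α.take i).length + 1
      · rw [Finset.sum_eq_single ⟨a, ha⟩]
        · simp only [if_true, one_mul]
          by_cases hb : (b : ℕ) = a + 1
          · have : (a : ℕ) < i := by omega
            simp [hb, this]
          · simp [hb]
        · intro c _ hc
          have : ¬ ((a : ℕ) = c) := fun h => hc (Fin.ext h.symm)
          simp [this]
        · simp
      · rw [Finset.sum_eq_zero]
        · have : ¬ ((b : ℕ) = a + 1) := by omega
          simp [this]
        · intro c _
          have : ¬ ((a : ℕ) = c) := by omega
          simp [this]
    · intro c _ hc
      have : ¬ ((c : ℕ) = b) := fun h => hc (Fin.ext h)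
      simp [X, this]
    · simp
  have h := congrFun (congrFun (herglotz_intertwines B hB _ _ X _ _ hX) 0) (Fin.last _)
  rw [mul_ampl_entry, ampl_mul_entry, Finset.sum_eq_single i, Finset.sum_eq_single 0] at h
  · simp only [X, Matrix.of_apply, Fin.val_last, hlen, if_true, one_smul, Fin.val_zero] at h
    have hpow : (2⁻¹ : ℂ) ^ (i : ℕ) * 2 ^ (α.take i).length = 1 := by
      rw [hlen, ← mul_pow]
      norm_num
    rw [h, LeftSchur.herglotzCoeff, taylorCoeff, smul_smul, hpow, one_smul]
  · intro b _ hb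
    have : ¬ ((0 : ℕ) = b) := fun h => hb (Fin.ext h.symm)
    simp [X, this]
  · simp
  · intro b _ hb
    have : ¬ ((b : ℕ) = (α.take i).length) := fun h => hb (Fin.ext (by omega))
    simp only [X, Matrix.of_apply, Fin.val_last, this, if_false, zero_smul]
  · simp

/-- The index of the kernel vector at the upper right entry of a bidiagonal point. -/
def shiftIndex (α : Word d) : Point d :=
  ⟨α.length + 1, shiftPoint α, Pi.single 0 1, Pi.single (Fin.last _) 1⟩

theorem szego_shift (α β : Word d) (i : Fin (α.length + 1)) :
    szego (shiftPoint α) (shiftPoint β) (Matrix.vecMulVec (Pi.single (Fin.last _) 1)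
      (star (Pi.single (Fin.last _) 1))) i 0 =
    if α.length = i + β.length ∧ β <:+ α then (4⁻¹ : ℂ) ^ β.length else 0 := by
  have h := hasSum_szego (shiftPoint α) (shiftPoint β) (Pi.single (Fin.last _) 1)
    (Pi.single (Fin.last _) 1) i 0
  have h2 := hasSum_single (f := fun γ : Word d =>
    (wordPow (shiftPoint α).1 γ *ᵥ Pi.single (Fin.last _) 1) i *
      star ((wordPow (shiftPoint β).1 γ *ᵥ Pi.single (Fin.last _) 1) 0)) β (by
    intro γ hγ
    have : ¬ (β.length = γ.length ∧ γ <+: β) := fun ⟨hl, hp⟩ => hγ (hp.eq_of_length hl.symm)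
    simp [shiftPoint, wordPow_bidiagonal, this])
  rw [h.unique h2]
  have h3 : (α.length = i + β.length ∧ β <+: α.drop i) ↔ (α.length = i + β.length ∧ β <:+ α) := by
    refine and_congr_right fun hl => ⟨fun hp => ?_, fun hs => ?_⟩
    · have : β = α.drop i := hp.eq_of_length (by simp; omega)
      rw [this]
      exact List.drop_suffix _ _
    · have : β = α.drop i := by
        rw [List.suffix_iff_eq_drop.1 hs]
        congr 1
        omega
      rw [← this]
  simp only [shiftPoint, Matrix.mulVec_single_one, Matrix.col_apply, wordPow_bidiagonal,
    Fin.val_last, h3]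
  simp only [Fin.val_zero, zero_add, List.drop_zero, List.prefix_rfl, and_self, if_true]
  split_ifs
  · rw [RCLike.star_def, map_pow, ← mul_pow, map_inv₀, map_ofNat]
    norm_num
  · simp

/-! The Clark functional and its positivity. -/

/-- The Clark map on monomials, `μ_B(L^α) = ½ (H_∅ δ_{α,∅} + (H_{α†})^*)`; here `(H_{α†})^*` is the
coefficient at `1` of `H_A(R)^* L^α 1 = ∑_{γ β = α} L^γ 1 (H_{β†})^*`, where `A = B†`. -/
def LeftSchur.clark (B : LeftSchur d H) (α : Word d) : H →L[ℂ] H :=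
  (2⁻¹ : ℂ) • ((if α = [] then B.herglotzCoeff [] else 0) +
    ContinuousLinearMap.adjoint (B.herglotzCoeff α.reverse))

/-- The operators `μ_B((L^α)^* L^β)`: since `L_i^* L_j = δ_{ij} I`, the product `(L^α)^* L^β` is
`L^γ` if `β = α γ`, it is `(L^γ)^*` if `α = β γ`, and it is `0` otherwise. -/
def LeftSchur.clarkGram (B : LeftSchur d H) : Matrix (Word d) (Word d) (H →L[ℂ] H) :=
  Matrix.of fun α β =>
    if α <+: β then B.clark (β.drop α.length)
    else if β <+: α then ContinuousLinearMap.adjoint (B.clark (α.drop β.length))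
    else 0

theorem szego_conj {n m : ℕ} (Z : Ball d n) (W : Ball d m) (v : Fin n → ℂ) (u : Fin m → ℂ)
    (i : Fin n) (k : Fin m) : szego Z W (Matrix.vecMulVec v (star u)) i k =
      star (szego W Z (Matrix.vecMulVec u (star v)) k i) := by
  refine (hasSum_szego Z W v u i k).unique ?_
  convert (hasSum_szego W Z u v k i).star using 1
  funext α
  simp [mul_comm]

theorem sum_szego_shift (B : LeftSchur d H) (hB : B.CayleyDefined) (α β : Word d) :
    ∑ j, szego (shiftPoint α) (shiftPoint β) (Matrix.vecMulVec (Pi.single (Fin.last _) 1)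
      (star (Pi.single (Fin.last _) 1))) j 0 • B.herglotz _ (shiftPoint α) 0 j =
    (2⁻¹ : ℂ) ^ (α.length + β.length) •
      if β <:+ α then B.herglotzCoeff (α.take (α.length - β.length)) else 0 := by
  simp only [szego_shift]
  by_cases h : β <:+ α
  · have hle := h.length_le
    rw [Finset.sum_eq_single (⟨α.length - β.length, by omega⟩ : Fin (α.length + 1))]
    · have : α.length = α.length - β.length + β.length := by omega
      rw [if_pos ⟨this, h⟩, if_pos h, herglotz_shift_entry B hB, smul_smul]
      congr 1
      have h2 : α.length + β.length = 2 * β.length + (α.length - β.length) := by omega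
      rw [h2, pow_add, pow_mul]
      norm_num
    · intro j _ hj
      rw [if_neg, zero_smul]
      rintro ⟨h1, -⟩
      exact hj (Fin.ext (by simp; omega))
    · simp
  · simp [h]

theorem gram_shift (B : LeftSchur d H) (hB : B.CayleyDefined) (α β : Word d) :
    B.gram (shiftIndex α) (shiftIndex β) =
      (2⁻¹ : ℂ) ^ (α.length + β.length) • B.clarkGram α.reverse β.reverse := by
  have e1 : B.gram (shiftIndex α) (shiftIndex β) =
      B.herglotzKernel (shiftPoint α) (shiftPoint β)
        (Matrix.vecMulVec (Pi.single (Fin.last _) 1) (star (Pi.single (Fin.last _) 1))) 0 0 := by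
    simp only [LeftSchur.gram, shiftIndex, Matrix.of_apply]
    rw [Finset.sum_eq_single 0, Finset.sum_eq_single 0]
    · simp
    · intro b _ hb
      simp [hb]
    · simp
    · intro b _ hb
      simp [hb]
    · simp
  have e2 : ∑ j, szego (shiftPoint α) (shiftPoint β) (Matrix.vecMulVec (Pi.single (Fin.last _) 1)
      (star (Pi.single (Fin.last _) 1))) 0 j • (B.herglotz _ (shiftPoint β))ᴴ j 0 =
      star (∑ j, szego (shiftPoint β) (shiftPoint α) (Matrix.vecMulVec (Pi.single (Fin.last _) 1)
        (star (Pi.single (Fin.last _) 1))) j 0 • B.herglotz _ (shiftPoint β) 0 j) := by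
    rw [star_sum]
    refine Finset.sum_congr rfl fun j _ => ?_
    rw [szego_conj, star_smul, Matrix.conjTranspose_apply]
  rw [e1, LeftSchur.herglotzKernel, Matrix.smul_apply, Matrix.add_apply, mul_ampl_entry,
    ampl_mul_entry, e2, sum_szego_shift B hB, sum_szego_shift B hB, star_smul, star_pow,
    Nat.add_comm β.length]
  have e3 : star (2⁻¹ : ℂ) = 2⁻¹ := by simp
  rw [e3, ← smul_add, smul_comm]
  congr 1
  simp only [LeftSchur.clarkGram, Matrix.of_apply, List.reverse_prefix, List.length_reverse,
    List.drop_reverse]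
  by_cases h1 : α <:+ β
  · by_cases h2 : β <:+ α
    · have hab : α = β := h1.eq_of_length (le_antisymm h1.length_le h2.length_le)
      subst hab
      simp [LeftSchur.clark, ContinuousLinearMap.star_eq_adjoint]
    · have h3 : (β.take (β.length - α.length)).reverse ≠ [] := by
        intro h
        have hl := congrArg List.length h
        simp at hl
        have : α = β := h1.eq_of_length (le_antisymm h1.length_le (by
          omega))
        exact h2 (this ▸ List.suffix_rfl)
      simp only [h1, h2, if_true, if_false, LeftSchur.clark, h3, List.reverse_reverse, zero_add,
        ContinuousLinearMap.star_eq_adjoint]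
  · by_cases h2 : β <:+ α
    · have h3 : (α.take (α.length - β.length)).reverse ≠ [] := by
        intro h
        have hl := congrArg List.length h
        simp at hl
        have : β = α := h2.eq_of_length (le_antisymm h2.length_le (by
          omega))
        exact h1 (this ▸ List.suffix_rfl)
      simp only [h1, h2, if_true, if_false, LeftSchur.clark, h3, List.reverse_reverse, zero_add,
        ← ContinuousLinearMap.star_eq_adjoint, star_zero, add_zero, star_smul, star_star, e3]
    · simp [h1, h2]

theorem kvec_expand {n : ℕ} (Z : Ball d n) (v y : Fin n → ℂ) (h : H)
    (A : Matrix (Fin n) (Fin n) (H →L[ℂ] H)) :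
    kvec Z v (act A fun i => y i • h) = ∑ i, ∑ j, (y i * star (v j)) •
      kvec Z (Pi.single j 1) (act A fun k => (Pi.single i 1 : Fin n → ℂ) k • h) := by
  refine lp.ext (funext fun α => ?_)
  simp only [lp.coeFn_sum, lp.coeFn_smul, Finset.sum_apply, Pi.smul_apply, kvec_apply]
  have e1 : ∀ i l, act A (fun k => (Pi.single i 1 : Fin n → ℂ) k • h) l = A l i h := by
    intro i l
    rw [act, Finset.sum_eq_single i]
    · simp
    · intro b _ hb
      simp [hb]
    · simp
  have e2 : ∀ l, act A (fun k => y k • h) l = ∑ i, y i • A l i h := by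
    intro l
    simp [act]
  have e3 : ∀ l, star ((wordPow Z.1 α *ᵥ v) l) = ∑ j, star (v j) * star (wordPow Z.1 α l j) := by
    intro l
    simp [Matrix.mulVec, dotProduct, mul_comm]
  simp only [e1, e2, e3, Matrix.mulVec_single_one, Matrix.col_apply]
  simp only [Finset.smul_sum, smul_smul]
  rw [Finset.sum_comm]
  refine Finset.sum_congr rfl fun i _ => ?_
  rw [Finset.sum_comm]
  refine Finset.sum_congr rfl fun l _ => ?_
  rw [← Finset.sum_smul, Finset.sum_mul]
  congr 1
  exact Finset.sum_congr rfl fun j _ => by ring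

/-! The Herglotz space. -/

/-- The left free Herglotz space `ℋ^L_+(H_B)`: the completion of the span of the kernel vectors
`K{Z,y,v}h` with `⟪K{Z,y,v}h, K{W,x,u}g⟫ = ⟪y ⊗ h, K^{H_B}(Z,W)[v u^*] (x ⊗ g)⟫`. -/
def HerglotzSpace (B : LeftSchur d H) (hB : B.CayleyDefined) : Type _ :=
  haveI : Fact B.gram.PosSemidef := ⟨gram_posSemidef B hB⟩
  RKHS.OfKernel B.gram

namespace HerglotzSpace

variable (B : LeftSchur d H) (hB : B.CayleyDefined)

instance : NormedAddCommGroup (HerglotzSpace B hB) :=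
  haveI : Fact B.gram.PosSemidef := ⟨gram_posSemidef B hB⟩
  inferInstanceAs (NormedAddCommGroup (RKHS.OfKernel B.gram))

instance : InnerProductSpace ℂ (HerglotzSpace B hB) :=
  haveI : Fact B.gram.PosSemidef := ⟨gram_posSemidef B hB⟩
  inferInstanceAs (InnerProductSpace ℂ (RKHS.OfKernel B.gram))

instance : CompleteSpace (HerglotzSpace B hB) :=
  haveI : Fact B.gram.PosSemidef := ⟨gram_posSemidef B hB⟩
  inferInstanceAs (CompleteSpace (RKHS.OfKernel B.gram))

instance : RKHS ℂ (HerglotzSpace B hB) (Point d) H :=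
  haveI : Fact B.gram.PosSemidef := ⟨gram_posSemidef B hB⟩
  inferInstanceAs (RKHS ℂ (RKHS.OfKernel B.gram) (Point d) H)

/-- The kernel vectors: `kerVec Z y v h` is `K^{H_B}{Z,y,v}h`. -/
def kerVec {n : ℕ} (Z : Ball d n) (y v : Fin n → ℂ) (h : H) : HerglotzSpace B hB :=
  RKHS.kerFun (HerglotzSpace B hB) ⟨n, Z, y, v⟩ h

theorem kernel_eq : RKHS.kernel (HerglotzSpace B hB) = B.gram :=
  haveI : Fact B.gram.PosSemidef := ⟨gram_posSemidef B hB⟩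
  RKHS.OfKernel.kernel_ofKernel (K := B.gram)

/-- The value `F(Z)`, an `n × n` matrix over `H`, of an element of the Herglotz space. -/
def value {B : LeftSchur d H} {hB : B.CayleyDefined} (F : HerglotzSpace B hB) (n : ℕ)
    (Z : Ball d n) : Matrix (Fin n) (Fin n) H :=
  Matrix.of fun i j => F ⟨n, Z, Pi.single i 1, Pi.single j 1⟩

theorem kerVec_inner {n m : ℕ} (Z : Ball d n) (y v : Fin n → ℂ) (h : H) (W : Ball d m)
    (x u : Fin m → ℂ) (g : H) : ⟪kerVec B hB Z y v h, kerVec B hB W x u g⟫_ℂ =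
      ∑ i, ∑ k, ⟪y i • h, B.herglotzKernel Z W (Matrix.vecMulVec v (star u)) i k (x k • g)⟫_ℂ := by
  have := RKHS.kerFun_inner (H := HerglotzSpace B hB) ⟨n, Z, y, v⟩ h (kerVec B hB W x u g)
  rw [kerVec, this, kerVec, RKHS.kerFun_apply, kernel_eq, dotH_gram]
  simp [dotH, act]

theorem kerVec_expand {n : ℕ} (Z : Ball d n) (y v : Fin n → ℂ) (h : H) :
    kerVec B hB Z y v h = ∑ i, ∑ j,
      (y i * star (v j)) • kerVec B hB Z (Pi.single i 1) (Pi.single j 1) h := by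
  refine RKHS.ext fun q => ext_inner_left ℂ fun g => ?_
  have e : ∀ (y v : Fin n → ℂ), ⟪g, kerVec B hB Z y v h q⟫_ℂ =
      ⟪g, B.gram q ⟨n, Z, y, v⟩ h⟫_ℂ := fun y v => by
    rw [kerVec, RKHS.kerFun_apply, kernel_eq]
  rw [← RKHS.kerFun_inner (H := HerglotzSpace B hB), ← RKHS.kerFun_inner (H := HerglotzSpace B hB)]
  simp only [inner_sum, inner_smul_right]
  simp only [RKHS.kerFun_inner, e, gram_eq B hB]
  have ea : kvec Z v (B.xi ⟨n, Z, y, v⟩ h) = ∑ i, ∑ j, (y i * star (v j)) •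
      kvec Z (Pi.single j 1) (B.xi ⟨n, Z, Pi.single i 1, Pi.single j 1⟩ h) :=
    kvec_expand Z v y h _
  have eb : kvec Z v (act (B.toFun n Z)ᴴ (B.xi ⟨n, Z, y, v⟩ h)) = ∑ i, ∑ j, (y i * star (v j)) •
      kvec Z (Pi.single j 1)
        (act (B.toFun n Z)ᴴ (B.xi ⟨n, Z, Pi.single i 1, Pi.single j 1⟩ h)) := by
    simp only [LeftSchur.xi, ← act_mul]
    exact kvec_expand Z v y h _
  rw [ea, eb]
  simp only [inner_sum, inner_smul_right, ← Finset.sum_sub_distrib, mul_sub]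

/-- The reproducing property `⟪K{Z,y,v}h, F⟫ = ⟪y ⊗ h, F(Z) v⟫`. -/
theorem kerVec_inner_left {B : LeftSchur d H} {hB : B.CayleyDefined} {n : ℕ} (Z : Ball d n)
    (y v : Fin n → ℂ) (h : H) (F : HerglotzSpace B hB) :
    ⟪kerVec B hB Z y v h, F⟫_ℂ = ∑ i, ∑ j, ⟪y i • h, v j • F.value n Z i j⟫_ℂ := by
  rw [kerVec_expand]
  simp only [sum_inner, inner_smul_left, inner_smul_right]
  refine Finset.sum_congr rfl fun i _ => Finset.sum_congr rfl fun j _ => ?_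
  rw [kerVec, RKHS.kerFun_inner, value, Matrix.of_apply, map_mul]
  simp
  ring

/-- Coefficient evaluation `F ↦ F_α`, as a bounded operator. -/
def coeffEval (α : Word d) : HerglotzSpace B hB →L[ℂ] H :=
  (2 : ℂ) ^ α.length • (ContinuousLinearMap.proj (shiftIndex α) ∘L
    RKHS.coeCLM ℂ (H := HerglotzSpace B hB))

theorem coeffEval_apply (α : Word d) (F : HerglotzSpace B hB) :
    coeffEval B hB α F = taylorCoeff F.value α := rfl

/-- The coefficient kernel map `K_α : H → ℋ^L_+(H_B)`, the adjoint of `F ↦ F_α`. -/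
def coeffKer (α : Word d) : H →L[ℂ] HerglotzSpace B hB :=
  ContinuousLinearMap.adjoint (coeffEval B hB α)

end HerglotzSpace

theorem HerglotzSpace.coeffKer_eq (B : LeftSchur d H) (hB : B.CayleyDefined) (α : Word d) (h : H) :
    coeffKer B hB α h = (2 : ℂ) ^ α.length •
      kerVec B hB (shiftPoint α) (Pi.single 0 1) (Pi.single (Fin.last _) 1) h := by
  refine ext_inner_right ℂ fun F => ?_
  rw [coeffKer, ContinuousLinearMap.adjoint_inner_left, inner_smul_left, kerVec,
    RKHS.kerFun_inner, coeffEval_apply, taylorCoeff, inner_smul_right, map_pow, map_ofNat]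
  rfl

theorem HerglotzSpace.coeffKer_inner (B : LeftSchur d H) (hB : B.CayleyDefined) (α β : Word d)
    (h g : H) : ⟪coeffKer B hB α h, coeffKer B hB β g⟫_ℂ =
      ⟪h, B.clarkGram α.reverse β.reverse g⟫_ℂ := by
  have e : ⟪kerVec B hB (shiftPoint α) (Pi.single 0 1) (Pi.single (Fin.last _) 1) h,
      kerVec B hB (shiftPoint β) (Pi.single 0 1) (Pi.single (Fin.last _) 1) g⟫_ℂ =
      ⟪h, B.gram (shiftIndex α) (shiftIndex β) g⟫_ℂ := by
    rw [kerVec, RKHS.kerFun_inner, kerVec, RKHS.kerFun_apply, kernel_eq]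
    rfl
  rw [coeffKer_eq, coeffKer_eq, inner_smul_left, inner_smul_right, e, gram_shift B hB,
    smul_apply, inner_smul_right, ← mul_assoc, ← mul_assoc, map_pow, map_ofNat, ← pow_add,
    ← mul_pow]
  norm_num

theorem clarkGram_posSemidef (B : LeftSchur d H) (hB : B.CayleyDefined) :
    B.clarkGram.PosSemidef := by
  refine posSemidef_of_gram (fun α h => HerglotzSpace.coeffKer B hB α.reverse h)
    (fun _ _ => 0) (fun α β h g => ?_) fun s => ?_
  · rw [HerglotzSpace.coeffKer_inner]
    simp
  · simp

/-! The free Hardy space of the Clark map. -/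

/-- The space `F^2(μ_B)`: the completion of the span of the vectors `L^α ⊗ h` with
`⟪L^α ⊗ h, L^β ⊗ g⟫ = ⟪h, μ_B((L^α)^* L^β) g⟫`, modulo vectors of length zero. -/
def ClarkSpace (B : LeftSchur d H) (hB : B.CayleyDefined) : Type _ :=
  haveI : Fact B.clarkGram.PosSemidef := ⟨clarkGram_posSemidef B hB⟩
  RKHS.OfKernel B.clarkGram

namespace ClarkSpace

variable (B : LeftSchur d H) (hB : B.CayleyDefined)

instance : NormedAddCommGroup (ClarkSpace B hB) :=
  haveI : Fact B.clarkGram.PosSemidef := ⟨clarkGram_posSemidef B hB⟩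
  inferInstanceAs (NormedAddCommGroup (RKHS.OfKernel B.clarkGram))

instance : InnerProductSpace ℂ (ClarkSpace B hB) :=
  haveI : Fact B.clarkGram.PosSemidef := ⟨clarkGram_posSemidef B hB⟩
  inferInstanceAs (InnerProductSpace ℂ (RKHS.OfKernel B.clarkGram))

instance : CompleteSpace (ClarkSpace B hB) :=
  haveI : Fact B.clarkGram.PosSemidef := ⟨clarkGram_posSemidef B hB⟩
  inferInstanceAs (CompleteSpace (RKHS.OfKernel B.clarkGram))

instance : RKHS ℂ (ClarkSpace B hB) (Word d) H :=
  haveI : Fact B.clarkGram.PosSemidef := ⟨clarkGram_posSemidef B hB⟩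
  inferInstanceAs (RKHS ℂ (RKHS.OfKernel B.clarkGram) (Word d) H)

/-- The vector `L^α ⊗ h`. -/
def mono (α : Word d) : H →L[ℂ] ClarkSpace B hB := RKHS.kerFun (ClarkSpace B hB) α

theorem mono_inner (α β : Word d) (h g : H) :
    ⟪mono B hB α h, mono B hB β g⟫_ℂ = ⟪h, B.clarkGram α β g⟫_ℂ := by
  have : Fact B.clarkGram.PosSemidef := ⟨clarkGram_posSemidef B hB⟩
  have e : RKHS.kernel (ClarkSpace B hB) = B.clarkGram :=
    RKHS.OfKernel.kernel_ofKernel (K := B.clarkGram)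
  rw [mono, mono, RKHS.kerFun_inner, RKHS.kerFun_apply, e]

/-- The finite linear combinations of the vectors `L^α ⊗ h`. -/
def poly : (Word d × H →₀ ℂ) →ₗ[ℂ] ClarkSpace B hB :=
  Finsupp.linearCombination ℂ fun p => mono B hB p.1 p.2

theorem poly_dense : DenseRange (poly B hB) := by
  have h := RKHS.kerFun_dense (ClarkSpace B hB) (𝕜 := ℂ)
  have e : Set.range (poly B hB) =
      (Submodule.span ℂ {RKHS.kerFun (ClarkSpace B hB) x v | (x) (v)} : Set (ClarkSpace B hB)) := by
    rw [← LinearMap.coe_range, poly, Finsupp.range_linearCombination]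
    congr 2
    ext F
    simp [mono]
  rw [DenseRange, e]
  exact (Submodule.dense_iff_topologicalClosure_eq_top).2 h

/-- The subspace `F^2_0(μ_B)`, the closed span of the vectors `L^α ⊗ h` with `α ≠ ∅`. -/
def nonconstant : Submodule ℂ (ClarkSpace B hB) :=
  (Submodule.span ℂ {F | ∃ (α : Word d) (h : H), α ≠ [] ∧ F = mono B hB α h}).topologicalClosure

/-- A linear map on polynomials that preserves the Gram matrix of the `L^α ⊗ h` preserves norms. -/
theorem norm_of_gram {E : Type*} [NormedAddCommGroup E] [InnerProductSpace ℂ E]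
    (a : Word d × H → E) (ha : ∀ p q, ⟪a p, a q⟫_ℂ = ⟪p.2, B.clarkGram p.1 q.1 q.2⟫_ℂ)
    (x : Word d × H →₀ ℂ) : ‖Finsupp.linearCombination ℂ a x‖ = ‖poly B hB x‖ := by
  have : ⟪Finsupp.linearCombination ℂ a x, Finsupp.linearCombination ℂ a x⟫_ℂ =
      ⟪poly B hB x, poly B hB x⟫_ℂ := by
    simp only [poly, Finsupp.linearCombination_apply, Finsupp.sum, sum_inner, inner_sum,
      inner_smul_left, inner_smul_right, ha, mono_inner]
  rw [← sq_eq_sq₀ (norm_nonneg _) (norm_nonneg _), ← inner_self_eq_norm_sq (𝕜 := ℂ),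
    ← inner_self_eq_norm_sq (𝕜 := ℂ), this]

/-- The components `Π_k = π_B(L_k)` of the GNS row isometry: `L^α ⊗ h ↦ L_k L^α ⊗ h`, extended by
linearity and continuity. -/
def gns (k : Fin d) : ClarkSpace B hB →L[ℂ] ClarkSpace B hB :=
  (Finsupp.linearCombination ℂ fun p : Word d × H => mono B hB (k :: p.1) p.2).extendOfNorm
    (poly B hB)

theorem clarkGram_cons (k : Fin d) (α β : Word d) :
    B.clarkGram (k :: α) (k :: β) = B.clarkGram α β := by
  simp [LeftSchur.clarkGram]

theorem poly_single (α : Word d) (h : H) :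
    poly B hB (Finsupp.single (α, h) 1) = mono B hB α h := by
  simp [poly]

theorem gns_mono (k : Fin d) (α : Word d) (h : H) :
    gns B hB k (mono B hB α h) = mono B hB (k :: α) h := by
  have hn : ∀ x, ‖Finsupp.linearCombination ℂ (fun p : Word d × H => mono B hB (k :: p.1) p.2) x‖ ≤
      1 * ‖poly B hB x‖ := fun x => by
    rw [one_mul, norm_of_gram B hB]
    intro p q
    rw [mono_inner, clarkGram_cons]
  rw [gns, ← poly_single, LinearMap.extendOfNorm_eq (poly_dense B hB) ⟨1, hn⟩]
  simp

/-- The left free Cauchy transform `𝒞^L : F^2(μ_B) → ℋ^L_+(H_B)`: `L^α ⊗ h ↦ K_{α†} h`, extended by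
linearity and continuity. -/
def cauchy : ClarkSpace B hB →L[ℂ] HerglotzSpace B hB :=
  (Finsupp.linearCombination ℂ fun p : Word d × H =>
    HerglotzSpace.coeffKer B hB p.1.reverse p.2).extendOfNorm (poly B hB)

theorem cauchy_mono (α : Word d) (h : H) :
    cauchy B hB (mono B hB α h) = HerglotzSpace.coeffKer B hB α.reverse h := by
  have hn : ∀ x, ‖Finsupp.linearCombination ℂ (fun p : Word d × H =>
      HerglotzSpace.coeffKer B hB p.1.reverse p.2) x‖ ≤ 1 * ‖poly B hB x‖ := fun x => by
    rw [one_mul, norm_of_gram B hB]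
    intro p q
    rw [HerglotzSpace.coeffKer_inner, List.reverse_reverse, List.reverse_reverse]
  rw [cauchy, ← poly_single, LinearMap.extendOfNorm_eq (poly_dense B hB) ⟨1, hn⟩]
  simp

end ClarkSpace

/-- The components `V_j = 𝒞^L π_B(L_j) (𝒞^L)^*` of the row isometry `V^B`. -/
def LeftSchur.V (B : LeftSchur d H) (hB : B.CayleyDefined) (j : Fin d) :
    HerglotzSpace B hB →L[ℂ] HerglotzSpace B hB :=
  ClarkSpace.cauchy B hB ∘L ClarkSpace.gns B hB j ∘L
    ContinuousLinearMap.adjoint (ClarkSpace.cauchy B hB)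

/-- The row operator `V^B : ℋ^L_+(H_B) ⊗ ℂ^d → ℋ^L_+(H_B)`, `(F_1, ..., F_d) ↦ V_1 F_1 + ⋯ + V_d F_d`,
on the Hilbert space direct sum of `d` copies. -/
def LeftSchur.row (B : LeftSchur d H) (hB : B.CayleyDefined) :
    PiLp 2 (fun _ : Fin d => HerglotzSpace B hB) →L[ℂ] HerglotzSpace B hB :=
  ∑ j, B.V hB j ∘L PiLp.proj 2 (fun _ : Fin d => HerglotzSpace B hB) j

end Hardy

end FreeHerglotz

end

open scoped ComplexOrder Matrix

noncomputable section

namespace FreeHerglotz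

open scoped InnerProductSpace
open Filter Topology

set_option linter.unusedSectionVars false

variable {d : ℕ} {H : Type*} [NormedAddCommGroup H] [InnerProductSpace ℂ H] [CompleteSpace H]

/-! Dilations inside the ball. -/

/-! Everything follows from the expansion `F(Z) = ∑ Z^α ⊗ F_α` on the whole ball
(`HerglotzSpace.hasSum_value`). Once it is known, an element of the Herglotz space is determined by
its coefficients, so the coefficient kernels `K_α h` are total and every statement can be checked on
them.

Convergence. Coefficient kernels of words of equal length are mutually orthogonal with a common Gram
operator, so a Bessel estimate bounds the square sum of the coefficients on each level, uniformly in
the level (`HerglotzSpace.sum_level_le`). Each point `Z` of the ball can be enlarged to `tZ` with `t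
> 1` inside the ball, and the gained factor `t^{-|α|}` makes the series absolutely convergent.

Identification of the sum. For a kernel vector `F`, the product `(I - B) F` is a free Hardy function
`p` (`HerglotzSpace.exists_value_kerVec`). If `f_N` is the truncated series of `F`, then `q_N = f_N
- B f_N - p` is a Hardy function with values `(I - B)(f_N - F)` and no coefficients of length below
`N`. Its norm grows at most like `r^{-N}` for any `r < 1`, whereas evaluation at `Z` of a function
starting at length `N` gains `t^{-N}`. Hence `q_N(Z)` tends to `0`, and applying `(I - B(Z))⁻¹`
shows `f_N(Z) → F(Z)` (`hasSum_of_opMul_eq_hardyEval`). Density of the kernel vectors and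
boundedness of both sides extend this to all `F`. The series of `H_B` is read off from the kernel
vector at the origin.

The row isometry. The Gram matrix of the `K_α` is that of the `L^{α†}`, so the Cauchy transform is
unitary and `V_j K_α = K_{αj}`. The relations `L_i^* L_j = δ_{ij}` give `V_i^* V_j = δ_{ij}`, and
the range is spanned by the `K_α` with `α ≠ ∅`. The adjoint formula compares expansions of
`⟪K{Z,y,v}h, V_j F⟫`: only the words `βj` and the empty word can contribute, the origin vector
removes the latter, and `Z^{βj} v = Z^β (Z_j v)`. -/

theorem dotProduct_defect {n : ℕ} (Z : Fin d → Matrix (Fin n) (Fin n) ℂ) (x : Fin n → ℂ) :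
    star x ⬝ᵥ ((1 - ∑ j, Z j * (Z j)ᴴ) *ᵥ x) =
      ((nsq x - ∑ j, nsq (Matrix.vecMul (star x) (Z j)) : ℝ) : ℂ) := by
  rw [Matrix.sub_mulVec, dotProduct_sub, Matrix.one_mulVec, Matrix.sum_mulVec, dotProduct_sum]
  push_cast
  congr 1
  · rw [nsq_eq]
  · refine Finset.sum_congr rfl fun j _ => ?_
    rw [nsq_eq, ← Matrix.mulVec_mulVec, Matrix.dotProduct_mulVec]
    conv_lhs => rw [← star_star x, ← Matrix.star_vecMul, star_star]
    rw [dotProduct_comm]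

/-- The ball is open along rays. With `∑ |x Z_j|² ≤ (1 - δ)|x|²`, scaling by `√(1 + δ)` still leaves
a defect of at least `δ²|x|²`. -/
theorem exists_dilation {n : ℕ} (Z : Ball d n) :
    ∃ t : ℝ, 1 < t ∧ ∃ W : Ball d n, ∀ j, W.1 j = (t : ℂ) • Z.1 j := by
  obtain ⟨ε, hε, h⟩ := ball_step Z
  set δ := min ε 1 with hδ
  have hδ0 : 0 < δ := lt_min hε one_pos
  have hsq : Real.sqrt (1 + δ) ^ 2 = 1 + δ := Real.sq_sqrt (by linarith)
  have hnsq : ∀ x : Fin n → ℂ, nsq ((Real.sqrt (1 + δ) : ℂ) • x) = (1 + δ) * nsq x := fun x => by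
    simp only [nsq, Pi.smul_apply, norm_smul, mul_pow, Complex.norm_real, Real.norm_eq_abs, sq_abs,
      hsq, Finset.mul_sum]
  refine ⟨Real.sqrt (1 + δ), Real.lt_sqrt_of_sq_lt (by linarith),
    ⟨fun j => (Real.sqrt (1 + δ) : ℂ) • Z.1 j, ?_⟩, fun j => rfl⟩
  refine Matrix.posDef_iff_dotProduct_mulVec.2 ⟨?_, fun x hx => ?_⟩
  · refine Matrix.isHermitian_one.sub ?_
    rw [Matrix.IsHermitian, Matrix.conjTranspose_sum]
    exact Finset.sum_congr rfl fun j _ => by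
      rw [Matrix.conjTranspose_mul, Matrix.conjTranspose_conjTranspose]
  · rw [dotProduct_defect]
    have h0 : 0 < nsq x := by
      refine lt_of_le_of_ne (nsq_nonneg x) fun h0 => hx ?_
      funext i
      have := (Finset.sum_eq_zero_iff_of_nonneg fun i _ => by positivity).1 h0.symm i
        (Finset.mem_univ i)
      simpa using this
    have h1 := h (star x)
    rw [nsq_star] at h1
    have h2 : ∑ j, nsq (Matrix.vecMul (star x) (Z.1 j)) ≤ (1 - δ) * nsq x := by
      have : δ * nsq x ≤ ε * nsq x := by gcongr; exact min_le_left _ _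
      linarith
    have h3 : 0 < nsq x - ∑ j, nsq (Matrix.vecMul (star x) ((Real.sqrt (1 + δ) : ℂ) • Z.1 j)) := by
      simp only [Matrix.vecMul_smul, hnsq, ← Finset.mul_sum]
      nlinarith [mul_le_mul_of_nonneg_left h2 (by linarith : 0 ≤ 1 + δ),
        mul_pos (mul_pos hδ0 hδ0) h0]
    exact_mod_cast h3

theorem wordPow_dilation {n : ℕ} {t : ℂ} {Z W : Fin d → Matrix (Fin n) (Fin n) ℂ}
    (h : ∀ j, W j = t • Z j) (α : Word d) : wordPow W α = t ^ α.length • wordPow Z α := by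
  induction α with
  | nil => simp [wordPow]
  | cons j α ih =>
    rw [wordPow_cons, wordPow_cons, ih, h, List.length_cons, pow_succ', Matrix.smul_mul,
      Matrix.mul_smul, smul_smul]

theorem wordPow_intertwine {n m : ℕ} {X : Matrix (Fin n) (Fin m) ℂ}
    {Z : Fin d → Matrix (Fin n) (Fin n) ℂ} {W : Fin d → Matrix (Fin m) (Fin m) ℂ}
    (h : ∀ j, Z j * X = X * W j) (α : Word d) : wordPow Z α * X = X * wordPow W α := by
  induction α with
  | nil => simp [wordPow]
  | cons j α ih =>
    rw [wordPow_cons, wordPow_cons, Matrix.mul_assoc, ih, ← Matrix.mul_assoc, h, Matrix.mul_assoc]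

theorem wordPow_append {n : ℕ} (Z : Fin d → Matrix (Fin n) (Fin n) ℂ) (α β : Word d) :
    wordPow Z (α ++ β) = wordPow Z α * wordPow Z β := by
  simp [wordPow]

/-! Coefficient families of subexponential growth. -/

/-- The family `c` is square summable after any damping by `r ^ |α|`, `r < 1`. -/
def Subexp (c : Word d → H) : Prop :=
  ∀ r : ℝ, 0 < r → r < 1 → Summable fun α => (r ^ α.length * ‖c α‖) ^ 2

/-- Grouping words by length turns a uniform bound on each level into a geometric series in `r²`. -/
theorem sum_damped_le {c : Word d → H} {C : ℝ} (hC : 0 ≤ C)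
    (h : ∀ (k : ℕ) (s : Finset (Word d)), (∀ α ∈ s, α.length = k) → ∑ α ∈ s, ‖c α‖ ^ 2 ≤ C)
    {r : ℝ} (h0 : 0 < r) (h1 : r < 1) (s : Finset (Word d)) :
    ∑ α ∈ s, (r ^ α.length * ‖c α‖) ^ 2 ≤ (1 - r ^ 2)⁻¹ * C := by
  classical
  have hr : r ^ 2 < 1 := pow_lt_one₀ h0.le h1 two_ne_zero
  have hg := hasSum_geometric_of_lt_one (sq_nonneg r) hr
  rw [← Finset.sum_fiberwise_of_maps_to (s := s) (t := s.image List.length) (g := List.length)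
    fun α hα => Finset.mem_image_of_mem _ hα]
  calc ∑ k ∈ s.image List.length, ∑ α ∈ s with α.length = k, (r ^ α.length * ‖c α‖) ^ 2
      ≤ ∑ k ∈ s.image List.length, (r ^ 2) ^ k * C := Finset.sum_le_sum fun k _ => by
        have : ∀ α ∈ s.filter fun α => α.length = k,
            (r ^ α.length * ‖c α‖) ^ 2 = (r ^ 2) ^ k * ‖c α‖ ^ 2 := fun α hα => by
          rw [(Finset.mem_filter.1 hα).2]
          ring
        rw [Finset.sum_congr rfl this, ← Finset.mul_sum]
        gcongr
        exact h k _ fun α hα => (Finset.mem_filter.1 hα).2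
    _ = (∑ k ∈ s.image List.length, (r ^ 2) ^ k) * C := (Finset.sum_mul ..).symm
    _ ≤ (1 - r ^ 2)⁻¹ * C := by
        gcongr
        rw [← hg.tsum_eq]
        exact hg.summable.sum_le_tsum _ fun _ _ => by positivity

/-- Passing to the dilated point `W = tZ` moves a factor `t^{-|α|}` onto `c α`. What remains is a
product of two square summable families. -/
theorem summable_norm_entry_mul {c : Word d → H} (hc : Subexp c) {n : ℕ} (Z : Ball d n)
    (i j : Fin n) : Summable fun α => ‖wordPow Z.1 α i j‖ * ‖c α‖ := by
  obtain ⟨t, ht, W, hW⟩ := exists_dilation Z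
  have ht0 : 0 < t := by linarith
  refine Summable.of_nonneg_of_le (fun _ => by positivity) (fun α => ?_)
    ((summable_entry W i j).add (hc t⁻¹ (by positivity) (inv_lt_one_of_one_lt₀ ht)))
  have e : ‖wordPow Z.1 α i j‖ * ‖c α‖ = ‖wordPow W.1 α i j‖ * (t⁻¹ ^ α.length * ‖c α‖) := by
    rw [wordPow_dilation hW, Matrix.smul_apply, norm_smul, norm_pow, Complex.norm_real,
      Real.norm_of_nonneg ht0.le, inv_pow]
    field_simp
  rw [e]
  nlinarith [sq_nonneg (‖wordPow W.1 α i j‖ - t⁻¹ ^ α.length * ‖c α‖),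
    sq_nonneg (‖wordPow W.1 α i j‖), sq_nonneg (t⁻¹ ^ α.length * ‖c α‖)]

theorem summable_entry_smul_of_subexp {c : Word d → H} (hc : Subexp c) {n : ℕ} (Z : Ball d n)
    (i j : Fin n) : Summable fun α => wordPow Z.1 α i j • c α :=
  Summable.of_norm <| by simpa only [norm_smul] using summable_norm_entry_mul hc Z i j

theorem Fock.hasSum_norm_sq (f : Fock d H) : HasSum (fun α => ‖f α‖ ^ 2) (‖f‖ ^ 2) := by
  have := lp.hasSum_norm (p := 2) (by norm_num) f
  simpa using this

theorem norm_trunc_le (c : Word d → H) (N : ℕ) {r : ℝ} (h0 : 0 < r) (h1 : r < 1) (α : Word d) :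
    ‖if α.length < N then c α else 0‖ ^ 2 ≤ (r⁻¹ ^ N) ^ 2 * (r ^ α.length * ‖c α‖) ^ 2 := by
  split_ifs with h
  · rw [← mul_pow]
    refine pow_le_pow_left₀ (norm_nonneg _) ?_ 2
    have : r ^ N ≤ r ^ α.length := pow_le_pow_of_le_one h0.le h1.le h.le
    calc ‖c α‖ = r⁻¹ ^ N * (r ^ N * ‖c α‖) := by rw [inv_pow]; field_simp
      _ ≤ _ := by gcongr
  · simp only [norm_zero, ne_eq, OfNat.ofNat_ne_zero, not_false_eq_true, zero_pow]
    positivity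

/-- The truncation of a family to the words of length less than `N`. -/
def trunc (c : Word d → H) (hc : Subexp c) (N : ℕ) : Fock d H :=
  ⟨fun α => if α.length < N then c α else 0, memℓp_gen <| by
    have := Summable.of_nonneg_of_le (fun _ => by positivity)
      (norm_trunc_le c N (r := 1 / 2) (by norm_num) (by norm_num))
      ((hc _ (by norm_num) (by norm_num)).mul_left _)
    simpa using this⟩

theorem trunc_apply (c : Word d → H) (hc : Subexp c) (N : ℕ) (α : Word d) :
    trunc c hc N α = if α.length < N then c α else 0 := rfl

/-- Undoing the damping on words shorter than `N` costs at most `r^{-N}`. Since `r` may be taken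
arbitrarily close to `1`, truncations grow slower than any given exponential. -/
theorem norm_sq_trunc_le (c : Word d → H) (hc : Subexp c) (N : ℕ) {r : ℝ} (h0 : 0 < r)
    (h1 : r < 1) :
    ‖trunc c hc N‖ ^ 2 ≤ (r⁻¹ ^ N) ^ 2 * ∑' α, (r ^ α.length * ‖c α‖) ^ 2 := by
  have h2 := (hc r h0 h1).hasSum.mul_left ((r⁻¹ ^ N) ^ 2)
  refine hasSum_le (fun α => ?_) (Fock.hasSum_norm_sq (trunc c hc N)) h2
  rw [trunc_apply]
  exact norm_trunc_le c N h0 h1 α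

/-! ### Evaluation of Hardy functions: truncations, tails and intertwinings. -/

theorem hasSum_hardyEval {n : ℕ} (f : Fock d H) (Z : Ball d n) (i j : Fin n) :
    HasSum (fun α => wordPow Z.1 α i j • f α) (hardyEval f Z i j) :=
  (summable_entry_smul f Z i j).hasSum

theorem hardyEval_sub {n : ℕ} (f g : Fock d H) (Z : Ball d n) :
    hardyEval (f - g) Z = hardyEval f Z - hardyEval g Z := by
  ext i j
  refine (hasSum_hardyEval (f - g) Z i j).unique ?_
  simpa [smul_sub] using (hasSum_hardyEval f Z i j).sub (hasSum_hardyEval g Z i j)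

theorem tendsto_hardyEval_trunc {c : Word d → H} (hc : Subexp c) {n : ℕ} (Z : Ball d n)
    (i j : Fin n) : Tendsto (fun N => hardyEval (trunc c hc N) Z i j) atTop
      (𝓝 (∑' α, wordPow Z.1 α i j • c α)) := by
  refine tendsto_tsum_of_dominated_convergence (summable_norm_entry_mul hc Z i j) (fun α => ?_)
    (Eventually.of_forall fun N α => ?_)
  · refine tendsto_const_nhds.congr' ?_
    filter_upwards [eventually_gt_atTop α.length] with N hN
    rw [trunc_apply, if_pos hN]
  · rw [trunc_apply, norm_smul]
    gcongr
    split_ifs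
    · rfl
    · simp

/-- Every surviving term carries `t^{-|α|} ≤ t^{-N}` once `Z^α` is replaced by `W^α`. The rest is
bounded by two convergent square sums. -/
theorem norm_hardyEval_le_of_tail {n : ℕ} {t : ℝ} (ht : 1 < t) {Z W : Ball d n}
    (hW : ∀ j, W.1 j = (t : ℂ) • Z.1 j) (i j : Fin n) {f : Fock d H} {N : ℕ}
    (hf : ∀ α : Word d, α.length < N → f α = 0) :
    ‖hardyEval f Z i j‖ ≤ t⁻¹ ^ N * ((∑' α, ‖wordPow W.1 α i j‖ ^ 2) + ‖f‖ ^ 2) := by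
  have ht0 : 0 < t := by linarith
  refine tsum_of_norm_bounded
    (((summable_entry W i j).hasSum.add (Fock.hasSum_norm_sq f)).mul_left _) fun α => ?_
  by_cases h : α.length < N
  · rw [hf α h, smul_zero, norm_zero]
    positivity
  · have h1 : ‖wordPow W.1 α i j‖ = t ^ α.length * ‖wordPow Z.1 α i j‖ := by
      rw [wordPow_dilation hW, Matrix.smul_apply, norm_smul, norm_pow, Complex.norm_real,
        Real.norm_of_nonneg ht0.le]
    have h2 : t⁻¹ ^ α.length ≤ t⁻¹ ^ N :=
      pow_le_pow_of_le_one (by positivity) (inv_le_one_of_one_le₀ ht.le) (not_lt.1 h)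
    calc ‖wordPow Z.1 α i j • f α‖ = t⁻¹ ^ α.length * (‖wordPow W.1 α i j‖ * ‖f α‖) := by
          rw [norm_smul, h1, inv_pow]
          field_simp
      _ ≤ t⁻¹ ^ N * (‖wordPow W.1 α i j‖ ^ 2 + ‖f α‖ ^ 2) := by
          gcongr
          nlinarith [sq_nonneg (‖wordPow W.1 α i j‖ - ‖f α‖), sq_nonneg (‖wordPow W.1 α i j‖),
            sq_nonneg ‖f α‖]

theorem taylorCoeff_hardyEval (f : Fock d H) (α : Word d) :
    taylorCoeff (fun _ Z => hardyEval f Z) α = f α :=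
  taylorCoeff_unique _ _ (fun _ Z i j => hasSum_hardyEval f Z i j) α

theorem hardyEval_intertwines {n m : ℕ} (f : Fock d H) (X : Matrix (Fin n) (Fin m) ℂ)
    {Z : Ball d n} {W : Ball d m} (h : ∀ j, Z.1 j * X = X * W.1 j) (i : Fin n) (k : Fin m) :
    ∑ j, X j k • hardyEval f Z i j = ∑ j, X i j • hardyEval f W j k := by
  have h1 := hasSum_sum fun j (_ : j ∈ Finset.univ) =>
    (hasSum_hardyEval f Z i j).const_smul (X j k)
  have h2 := hasSum_sum fun j (_ : j ∈ Finset.univ) =>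
    (hasSum_hardyEval f W j k).const_smul (X i j)
  refine h1.unique (h2.congr_fun fun α => ?_)
  have e := congrFun (congrFun (wordPow_intertwine h α) i) k
  simp only [Matrix.mul_apply] at e
  simp only [smul_smul, ← Finset.sum_smul, ← e]
  congr 1
  exact Finset.sum_congr rfl fun j _ => mul_comm _ _

/-! Products of operator matrices with matrices over `H`. -/

theorem opMul_mul {n m l p : ℕ} (A : Matrix (Fin n) (Fin m) (H →L[ℂ] H))
    (C : Matrix (Fin m) (Fin l) (H →L[ℂ] H)) (M : Matrix (Fin l) (Fin p) H) :
    opMul (A * C) M = opMul A (opMul C M) := by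
  ext i k
  simp only [opMul, Matrix.of_apply, Matrix.mul_apply, map_sum, sum_apply]
  rw [Finset.sum_comm]
  rfl

theorem opMul_one {n m : ℕ} (M : Matrix (Fin n) (Fin m) H) : opMul 1 M = M := by
  ext i k
  rw [opMul, Matrix.of_apply, Finset.sum_eq_single i]
  · simp
  · intro j _ hj
    simp [Matrix.one_apply_ne hj.symm]
  · simp

theorem sub_opMul {n m l : ℕ} (A C : Matrix (Fin n) (Fin m) (H →L[ℂ] H))
    (M : Matrix (Fin m) (Fin l) H) : opMul (A - C) M = opMul A M - opMul C M := by
  ext i k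
  simp [opMul]

theorem opMul_sub {n m l : ℕ} (A : Matrix (Fin n) (Fin m) (H →L[ℂ] H))
    (M N : Matrix (Fin m) (Fin l) H) : opMul A (M - N) = opMul A M - opMul A N := by
  ext i k
  simp [opMul]

/-! Expansion of free functions `F` such that `(I - B) F` is in the free Hardy space. -/

/-- `F` respects intertwinings. -/
def Intertwines (F : ∀ n : ℕ, Ball d n → Matrix (Fin n) (Fin n) H) : Prop :=
  ∀ (n m : ℕ) (X : Matrix (Fin n) (Fin m) ℂ) (Z : Ball d n) (W : Ball d m),
    (∀ j, Z.1 j * X = X * W.1 j) →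
      ∀ i k, ∑ j, X j k • F n Z i j = ∑ j, X i j • F m W j k

theorem Intertwines.opMul {A : ∀ n : ℕ, Ball d n → Matrix (Fin n) (Fin n) (H →L[ℂ] H)}
    {F : ∀ n : ℕ, Ball d n → Matrix (Fin n) (Fin n) H}
    (hA : ∀ (n m : ℕ) (X : Matrix (Fin n) (Fin m) ℂ) (Z : Ball d n) (W : Ball d m),
      (∀ j, Z.1 j * X = X * W.1 j) → A n Z * ampl H X = ampl H X * A m W)
    (hF : Intertwines F) : Intertwines fun n Z => opMul (A n Z) (F n Z) := by
  intro n m X Z W h i k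
  have hA' : ∀ l, ∑ j, X j l • A n Z i j = ∑ j, X i j • A m W j l := fun l => by
    have := congrFun (congrFun (hA n m X Z W h) i) l
    rwa [mul_ampl_entry, ampl_mul_entry] at this
  calc ∑ j, X j k • FreeHerglotz.opMul (A n Z) (F n Z) i j
      = ∑ l, A n Z i l (∑ j, X j k • F n Z l j) := by
        simp only [FreeHerglotz.opMul, Matrix.of_apply, Finset.smul_sum, map_sum, map_smul]
        exact Finset.sum_comm
    _ = ∑ l, (∑ j, X j l • A n Z i j) (F m W l k) := by
        simp only [hF n m X Z W h, map_sum, map_smul, sum_apply, smul_apply]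
        exact Finset.sum_comm
    _ = ∑ j, X i j • FreeHerglotz.opMul (A m W) (F m W) j k := by
        simp only [hA', FreeHerglotz.opMul, Matrix.of_apply, Finset.smul_sum, sum_apply,
          smul_apply]
        exact Finset.sum_comm

/-- The bidiagonal tuple of the suffix `α.drop k` is the lower right corner of that of `α`, and the
rectangular matrix `X` selecting the last coordinates intertwines the two. The last column at
`shiftPoint α` therefore lists the coefficients of the suffixes of `α`. -/
theorem Intertwines.shiftPoint_last {F : ∀ n : ℕ, Ball d n → Matrix (Fin n) (Fin n) H}
    (hF : Intertwines F) (α : Word d) (k : Fin (α.length + 1)) :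
    F _ (shiftPoint α) k (Fin.last _) =
      (2⁻¹ : ℂ) ^ (α.drop k).length • taylorCoeff F (α.drop k) := by
  have hlen : (α.drop k).length + k = α.length := by simp; omega
  let X : Matrix (Fin ((α.drop k).length + 1)) (Fin (α.length + 1)) ℂ :=
    Matrix.of fun b a => if (a : ℕ) = b + k then 1 else 0
  have hX : ∀ j, (shiftPoint (α.drop k)).1 j * X = X * (shiftPoint α).1 j := by
    intro j
    ext b a
    rw [Matrix.mul_apply, Matrix.mul_apply,
      Finset.sum_eq_single (⟨b + k, by omega⟩ : Fin (α.length + 1))]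
    · simp only [X, Matrix.of_apply, if_true, one_mul, shiftPoint, bidiagonal,
        List.getElem?_drop, Nat.add_comm (k : ℕ)]
      by_cases ha : (a : ℕ) = b + k + 1
      · have hb : (b : ℕ) + 1 < (α.drop k).length + 1 := by omega
        rw [Finset.sum_eq_single ⟨b + 1, hb⟩]
        · have e : (b : ℕ) + k + 1 = b + 1 + k := by omega
          simp [ha, e]
        · intro c _ hc
          have : ¬ ((c : ℕ) = b + 1) := fun h => hc (Fin.ext h)
          simp [this]
        · simp
      · rw [Finset.sum_eq_zero]
        · simp [ha]
        · intro c _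
          by_cases hc : (c : ℕ) = b + 1
          · have : ¬ ((a : ℕ) = c + k) := by omega
            simp [this]
          · simp [hc]
    · intro c _ hc
      have : ¬ ((c : ℕ) = b + k) := fun h => hc (Fin.ext h)
      simp [X, this]
    · simp
  have h := hF _ _ X _ _ hX 0 (Fin.last _)
  rw [Finset.sum_eq_single (Fin.last _), Finset.sum_eq_single k] at h
  · simp only [X, Matrix.of_apply, Fin.val_last, hlen, if_true, one_smul, Fin.val_zero,
      zero_add] at h
    rw [taylorCoeff, smul_smul, ← mul_pow, h]
    norm_num
  · intro b _ hb
    have : ¬ ((b : ℕ) = k) := fun h => hb (Fin.ext h)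
    simp [X, this]
  · simp
  · intro b _ hb
    have hb' : ¬ ((b : ℕ) = (α.drop k).length) := fun h => hb (Fin.ext h)
    have : ¬ (α.length = b + k) := by omega
    simp [X, this]
  · simp

/-- The last column at a bidiagonal point sees only the coefficients of suffixes of `α`. These are
shorter than `N`, so the truncation does not touch them. -/
theorem hardyEval_trunc_shiftPoint {F : ∀ n : ℕ, Ball d n → Matrix (Fin n) (Fin n) H}
    (hF : Intertwines F) (hc : Subexp (taylorCoeff F)) {N : ℕ} {α : Word d} (hα : α.length < N)
    (k : Fin (α.length + 1)) :
    hardyEval (trunc (taylorCoeff F) hc N) (shiftPoint α) k (Fin.last _) =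
      F _ (shiftPoint α) k (Fin.last _) := by
  have hlen : (α.drop k).length + k = α.length := by simp; omega
  rw [hF.shiftPoint_last]
  refine (hasSum_hardyEval _ _ _ _).unique ?_
  have h2 := hasSum_single (f := fun γ : Word d => wordPow (shiftPoint α).1 γ k (Fin.last _) •
    trunc (taylorCoeff F) hc N γ) (α.drop k) fun γ hγ => by
      rw [shiftPoint, wordPow_bidiagonal, if_neg, zero_smul]
      rintro ⟨hl, hp⟩
      rw [Fin.val_last] at hl
      exact hγ (hp.eq_of_length (by omega))
  convert h2 using 1
  rw [shiftPoint, wordPow_bidiagonal, if_pos ⟨by rw [Fin.val_last]; omega, List.prefix_rfl⟩,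
    trunc_apply, if_pos (by omega)]

/-- Convergence of the series alone does not identify its sum. The error is carried into the Hardy
space by multiplication by `I - B`, where its low coefficients vanish, and is brought back by the
inverse at the single point `Z`. -/
theorem hasSum_of_opMul_eq_hardyEval (B : LeftSchur d H) (hB : B.CayleyDefined)
    {F : ∀ n : ℕ, Ball d n → Matrix (Fin n) (Fin n) H} (hF : Intertwines F)
    (hc : Subexp (taylorCoeff F)) {p : Fock d H}
    (hp : ∀ (n : ℕ) (Z : Ball d n), opMul (1 - B.toFun n Z) (F n Z) = hardyEval p Z)
    {n : ℕ} (Z : Ball d n) (i j : Fin n) :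
    HasSum (fun α => wordPow Z.1 α i j • taylorCoeff F α) (F n Z i j) := by
  set f := trunc (taylorCoeff F) hc with hf
  choose m hm hmB using fun N => B.contractive_multiplier (f N)
  let q : ℕ → Fock d H := fun N => f N - m N - p
  have hq : ∀ N (n : ℕ) (Z : Ball d n),
      hardyEval (q N) Z = opMul (1 - B.toFun n Z) (hardyEval (f N) Z - F n Z) := by
    intro N n Z
    rw [opMul_sub, hp, sub_opMul, opMul_one, hmB, hardyEval_sub, hardyEval_sub]
  -- The coefficient at `α` is an entry in the last column at `shiftPoint α`. Left multiplication by
  -- `I - B` acts column by column, and this column of `f N - F` is zero.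
  have hq0 : ∀ N (α : Word d), α.length < N → q N α = 0 := by
    intro N α hα
    rw [← taylorCoeff_hardyEval, taylorCoeff, hq, opMul, Matrix.of_apply, Finset.sum_eq_zero,
      smul_zero]
    intro k _
    have : (hardyEval (f N) (shiftPoint α) - F _ (shiftPoint α)) k (Fin.last _) = 0 := by
      rw [Matrix.sub_apply, hf, hardyEval_trunc_shiftPoint hF hc hα, sub_self]
    rw [this, map_zero]
  obtain ⟨t, ht, W, hW⟩ := exists_dilation Z
  have ht0 : 0 < t := by linarith
  -- The squared norm of `f N` may grow like `r^{-2N}` while tail evaluation gains `t^{-N}`.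
  -- Choosing `r` between `√(1/t)` and `1` makes the product decay.
  have hsq : Real.sqrt t⁻¹ < 1 := by
    rw [Real.sqrt_lt' one_pos, one_pow]
    exact inv_lt_one_of_one_lt₀ ht
  obtain ⟨r, hr, hr1⟩ := exists_between hsq
  have hr0 : 0 < r := (Real.sqrt_nonneg _).trans_lt hr
  have htr : t⁻¹ * (r⁻¹) ^ 2 < 1 := by
    rw [inv_pow, ← div_eq_mul_inv, div_lt_one (by positivity)]
    exact Real.lt_sq_of_sqrt_lt hr
  have htail : ∀ k l, Tendsto (fun N => hardyEval (q N) Z k l) atTop (𝓝 0) := by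
    intro k l
    set a := ∑' α, ‖wordPow W.1 α k l‖ ^ 2
    set M := ∑' α : Word d, (r ^ α.length * ‖taylorCoeff F α‖) ^ 2
    have hlim : Tendsto (fun N : ℕ => t⁻¹ ^ N * (a + 2 * ‖p‖ ^ 2) +
        (t⁻¹ * (r⁻¹) ^ 2) ^ N * (8 * M)) atTop (𝓝 0) := by
      have h1 := (tendsto_pow_atTop_nhds_zero_of_lt_one (by positivity : (0 : ℝ) ≤ t⁻¹)
        (inv_lt_one_of_one_lt₀ ht)).mul_const (a + 2 * ‖p‖ ^ 2)
      have h2 := (tendsto_pow_atTop_nhds_zero_of_lt_one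
        (by positivity : (0 : ℝ) ≤ t⁻¹ * (r⁻¹) ^ 2) htr).mul_const (8 * M)
      simpa using h1.add h2
    refine squeeze_zero_norm (fun N => ?_) hlim
    refine (norm_hardyEval_le_of_tail ht hW k l (hq0 N)).trans ?_
    have h1 : ‖q N‖ ≤ 2 * ‖f N‖ + ‖p‖ := by
      calc ‖q N‖ ≤ ‖f N - m N‖ + ‖p‖ := norm_sub_le _ _
        _ ≤ ‖f N‖ + ‖m N‖ + ‖p‖ := by gcongr; exact norm_sub_le _ _
        _ ≤ 2 * ‖f N‖ + ‖p‖ := by linarith [hm N]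
    -- This is `(2a + b)² ≤ 8a² + 2b²`.
    have h2 : ‖q N‖ ^ 2 ≤ 8 * ‖f N‖ ^ 2 + 2 * ‖p‖ ^ 2 := by
      have := pow_le_pow_left₀ (norm_nonneg _) h1 2
      nlinarith [sq_nonneg (2 * ‖f N‖ - ‖p‖)]
    have h3 : ‖f N‖ ^ 2 ≤ (r⁻¹ ^ N) ^ 2 * M := norm_sq_trunc_le _ hc N hr0 hr1
    calc t⁻¹ ^ N * (a + ‖q N‖ ^ 2)
        ≤ t⁻¹ ^ N * (a + (8 * ((r⁻¹ ^ N) ^ 2 * M) + 2 * ‖p‖ ^ 2)) := by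
          gcongr
          linarith
      _ = _ := by
          rw [mul_pow]
          ring
  have hdiff : ∀ N, hardyEval (f N) Z i j - F n Z i j =
      ∑ k, Ring.inverse (1 - B.toFun n Z) i k (hardyEval (q N) Z k j) := by
    intro N
    have : opMul (Ring.inverse (1 - B.toFun n Z)) (hardyEval (q N) Z) =
        hardyEval (f N) Z - F n Z := by
      rw [hq, ← opMul_mul, Ring.inverse_mul_cancel _ (hB n Z), opMul_one]
    rw [← Matrix.sub_apply, ← this]
    rfl
  have hlim : Tendsto (fun N => hardyEval (f N) Z i j) atTop (𝓝 (F n Z i j)) := by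
    rw [← tendsto_sub_nhds_zero_iff]
    simp only [hdiff]
    rw [← Finset.sum_const_zero (s := (Finset.univ : Finset (Fin n)))]
    refine tendsto_finsetSum _ fun k _ => ?_
    have := ((Ring.inverse (1 - B.toFun n Z) i k).continuous.tendsto 0).comp (htail k j)
    rwa [map_zero] at this
  have := (summable_entry_smul_of_subexp hc Z i j).hasSum
  rwa [tendsto_nhds_unique (tendsto_hardyEval_trunc hc Z i j) hlim] at this

/-! Taylor-Taylor series in the Herglotz space. -/

theorem clarkGram_self (B : LeftSchur d H) (α : Word d) :
    B.clarkGram α α = B.clarkGram [] [] := by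
  simp [LeftSchur.clarkGram]

theorem clarkGram_of_length_eq (B : LeftSchur d H) {α β : Word d} (hl : α.length = β.length)
    (h : α ≠ β) : B.clarkGram α β = 0 := by
  have h1 : ¬ α <+: β := fun hp => h (hp.eq_of_length hl)
  have h2 : ¬ β <+: α := fun hp => h (hp.eq_of_length hl.symm).symm
  simp [LeftSchur.clarkGram, h1, h2]

namespace HerglotzSpace

variable {B : LeftSchur d H} {hB : B.CayleyDefined}

theorem coeffKer_inner_left (α : Word d) (h : H) (F : HerglotzSpace B hB) :
    ⟪coeffKer B hB α h, F⟫_ℂ = ⟪h, taylorCoeff F.value α⟫_ℂ := by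
  rw [coeffKer, ContinuousLinearMap.adjoint_inner_left, coeffEval_apply]

/-- Bessel's inequality, tested on `x = ∑ K_α F_α` over words of one length. Pairing `x` with `F`
gives the sum `S`, while orthogonality of the `K_α` gives `‖x‖² ≤ ‖μ_B(I)‖ S`; Cauchy–Schwarz then
bounds `S`. -/
theorem sum_level_le (F : HerglotzSpace B hB) (k : ℕ) (s : Finset (Word d))
    (hs : ∀ α ∈ s, α.length = k) :
    ∑ α ∈ s, ‖taylorCoeff F.value α‖ ^ 2 ≤ ‖B.clarkGram [] []‖ * ‖F‖ ^ 2 := by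
  classical
  set x := ∑ α ∈ s, coeffKer B hB α (taylorCoeff F.value α) with hx
  set S := ∑ α ∈ s, ‖taylorCoeff F.value α‖ ^ 2 with hS
  have hS0 : 0 ≤ S := Finset.sum_nonneg fun _ _ => by positivity
  have h1 : ⟪x, F⟫_ℂ = (S : ℂ) := by
    rw [hx, hS, sum_inner]
    push_cast
    refine Finset.sum_congr rfl fun α _ => ?_
    rw [coeffKer_inner_left, inner_self_eq_norm_sq_to_K]
    rfl
  have h2 : ‖x‖ ^ 2 ≤ ‖B.clarkGram [] []‖ * S := by
    have e : ⟪x, x⟫_ℂ = ∑ α ∈ s,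
        ⟪taylorCoeff F.value α, B.clarkGram [] [] (taylorCoeff F.value α)⟫_ℂ := by
      rw [hx]
      simp only [sum_inner, inner_sum, coeffKer_inner]
      refine Finset.sum_congr rfl fun α hα => ?_
      rw [Finset.sum_eq_single_of_mem α hα]
      · rw [clarkGram_self]
      · intro β hβ hne
        rw [clarkGram_of_length_eq B (by simp [hs α hα, hs β hβ])
          (fun h => hne (List.reverse_injective h))]
        simp
    rw [← inner_self_eq_norm_sq (𝕜 := ℂ), e, map_sum, hS, Finset.mul_sum]
    refine Finset.sum_le_sum fun α _ => ?_
    refine (re_inner_le_norm _ _).trans ?_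
    have := (B.clarkGram [] []).le_opNorm (taylorCoeff F.value α)
    nlinarith [norm_nonneg (taylorCoeff F.value α)]
  have h3 : S ≤ ‖x‖ * ‖F‖ := by
    have := norm_inner_le_norm (𝕜 := ℂ) x F
    rwa [h1, Complex.norm_real, Real.norm_of_nonneg hS0] at this
  -- The estimate obtained is quadratic in `S`, so one factor `S` has to be cancelled.
  rcases hS0.eq_or_lt with h0 | h0
  · rw [← h0]
    positivity
  · have h4 : S * S ≤ S * (‖B.clarkGram [] []‖ * ‖F‖ ^ 2) := by
      calc S * S ≤ (‖x‖ * ‖F‖) * (‖x‖ * ‖F‖) := by gcongr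
        _ = ‖x‖ ^ 2 * ‖F‖ ^ 2 := by ring
        _ ≤ (‖B.clarkGram [] []‖ * S) * ‖F‖ ^ 2 := by gcongr
        _ = _ := by ring
    exact le_of_mul_le_mul_left h4 h0

theorem sum_damped_taylorCoeff_le (F : HerglotzSpace B hB) {r : ℝ} (h0 : 0 < r) (h1 : r < 1)
    (s : Finset (Word d)) : ∑ α ∈ s, (r ^ α.length * ‖taylorCoeff F.value α‖) ^ 2 ≤
      (1 - r ^ 2)⁻¹ * (‖B.clarkGram [] []‖ * ‖F‖ ^ 2) :=
  sum_damped_le (by positivity) (sum_level_le F) h0 h1 s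

theorem subexp_taylorCoeff (F : HerglotzSpace B hB) : Subexp (taylorCoeff F.value) :=
  fun _ h0 h1 => summable_of_sum_le (fun _ => by positivity) (sum_damped_taylorCoeff_le F h0 h1)

theorem ext_value {F G : HerglotzSpace B hB} (h : ∀ n Z, F.value n Z = G.value n Z) : F = G := by
  refine RKHS.ext fun p => ext_inner_left ℂ fun g => ?_
  rw [← RKHS.kerFun_inner, ← RKHS.kerFun_inner]
  change ⟪kerVec B hB p.Z p.y p.v g, F⟫_ℂ = ⟪kerVec B hB p.Z p.y p.v g, G⟫_ℂ
  rw [kerVec_inner_left, kerVec_inner_left, h]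

/-- The factorization of the Herglotz kernel through `(I - B(Z))⁻¹` exhibits the kernel vector as
this inverse times `k - B k'`. Here `k` and `k'` are the Szegő kernel vectors at `ξ = (I -
B(W)^*)⁻¹(x ⊗ g)` and at `B(W)^* ξ`, so `k - B k'` is in the Hardy space. -/
theorem exists_value_kerVec {m : ℕ} (W : Ball d m) (x u : Fin m → ℂ) (g : H) :
    ∃ p : Fock d H, ∀ (n : ℕ) (Z : Ball d n), (kerVec B hB W x u g).value n Z =
      opMul (Ring.inverse (1 - B.toFun n Z)) (hardyEval p Z) := by
  let q : Point d := ⟨m, W, x, u⟩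
  obtain ⟨f, -, hf⟩ := B.contractive_multiplier (kvec W u (act (B.toFun m W)ᴴ (B.xi q g)))
  refine ⟨kvec W u (B.xi q g) - f, fun n Z => ?_⟩
  ext i j
  refine ext_inner_left ℂ fun h => ?_
  let p : Point d := ⟨n, Z, Pi.single i 1, Pi.single j 1⟩
  have e : ⟪h, (kerVec B hB W x u g).value n Z i j⟫_ℂ = ⟪h, B.gram p q g⟫_ℂ := by
    rw [value, Matrix.of_apply, kerVec, RKHS.kerFun_apply, kernel_eq]
  have e2 : ∀ M : Matrix (Fin n) (Fin n) H, dotH (fun k => (Pi.single i 1 : Fin n → ℂ) k • h)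
      (mulV M (Pi.single j 1)) = ⟪h, M i j⟫_ℂ := by
    intro M
    rw [dotH, Finset.sum_eq_single i]
    · rw [mulV, Finset.sum_eq_single j]
      · simp
      · intro b _ hb
        simp [hb]
      · simp
    · intro b _ hb
      simp [hb]
    · simp
  rw [e, gram_eq B hB, hasSum_kvec_inner, hasSum_kvec_inner, ← dotH_act, act_mulV, hf, ← dotH_sub]
  have e3 : mulV (hardyEval (kvec W u (B.xi q g)) Z) (Pi.single j 1) -
      mulV (hardyEval f Z) (Pi.single j 1) =
      mulV (hardyEval (kvec W u (B.xi q g) - f) Z) (Pi.single j 1) := by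
    funext l
    simp [mulV, hardyEval_sub, smul_sub]
  change dotH (B.xi p h) (mulV (hardyEval (kvec W u (B.xi q g)) Z) (Pi.single j 1) -
      mulV (hardyEval f Z) (Pi.single j 1)) = _
  rw [e3, LeftSchur.xi, ← dotH_act, act_mulV, e2]

theorem inverse_one_sub_intertwines (B : LeftSchur d H) (hB : B.CayleyDefined) (n m : ℕ)
    (X : Matrix (Fin n) (Fin m) ℂ) (Z : Ball d n) (W : Ball d m)
    (h : ∀ j, Z.1 j * X = X * W.1 j) :
    Ring.inverse (1 - B.toFun n Z) * ampl H X = ampl H X * Ring.inverse (1 - B.toFun m W) := by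
  have hX : (1 - B.toFun n Z) * ampl H X = ampl H X * (1 - B.toFun m W) := by
    rw [Matrix.sub_mul, Matrix.mul_sub, B.intertwines n m X Z W h, Matrix.one_mul, Matrix.mul_one]
  calc Ring.inverse (1 - B.toFun n Z) * ampl H X
      = Ring.inverse (1 - B.toFun n Z) * (ampl H X * (1 - B.toFun m W)) *
          Ring.inverse (1 - B.toFun m W) := by
        rw [Matrix.mul_assoc, Matrix.mul_assoc, Ring.mul_inverse_cancel _ (hB m W), Matrix.mul_one]
    _ = ampl H X * Ring.inverse (1 - B.toFun m W) := by
        rw [← hX, ← Matrix.mul_assoc, Ring.inverse_mul_cancel _ (hB n Z), Matrix.one_mul]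

theorem hasSum_value_kerVec {m : ℕ} (W : Ball d m) (x u : Fin m → ℂ) (g : H) {n : ℕ}
    (Z : Ball d n) (i j : Fin n) :
    HasSum (fun α => wordPow Z.1 α i j • taylorCoeff (kerVec B hB W x u g).value α)
      ((kerVec B hB W x u g).value n Z i j) := by
  obtain ⟨p, hp⟩ := exists_value_kerVec (hB := hB) W x u g
  refine hasSum_of_opMul_eq_hardyEval B hB ?_ (subexp_taylorCoeff _) (p := p) (fun n Z => ?_) Z i j
  · have e : (kerVec B hB W x u g).value =
        fun n Z => opMul (Ring.inverse (1 - B.toFun n Z)) (hardyEval p Z) := by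
      funext n Z
      exact hp n Z
    rw [e]
    exact Intertwines.opMul (F := fun _ Z => hardyEval p Z) (inverse_one_sub_intertwines B hB)
      fun _ _ X _ _ h => hardyEval_intertwines p X h
  · rw [hp, ← opMul_mul, Ring.mul_inverse_cancel _ (hB n Z), opMul_one]

/-- The bounded operator `F ↦ F(Z)_{ij}`. -/
def entryEval (B : LeftSchur d H) (hB : B.CayleyDefined) {n : ℕ} (Z : Ball d n) (i j : Fin n) :
    HerglotzSpace B hB →L[ℂ] H :=
  ContinuousLinearMap.proj (⟨n, Z, Pi.single i 1, Pi.single j 1⟩ : Point d) ∘L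
    RKHS.coeCLM ℂ (H := HerglotzSpace B hB)

theorem summable_series (F : HerglotzSpace B hB) {n : ℕ} (Z : Ball d n) (i j : Fin n) :
    Summable fun α => wordPow Z.1 α i j • taylorCoeff F.value α :=
  summable_entry_smul_of_subexp (subexp_taylorCoeff F) Z i j

/-- Makes the sum of the series a bounded operator in `F`, which is needed to pass from kernel
vectors to their closed span. -/
theorem exists_norm_series_le (B : LeftSchur d H) (hB : B.CayleyDefined) {n : ℕ} (Z : Ball d n)
    (i j : Fin n) : ∃ C : ℝ, ∀ F : HerglotzSpace B hB,
      ‖∑' α, wordPow Z.1 α i j • taylorCoeff F.value α‖ ≤ C * ‖F‖ := by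
  obtain ⟨t, ht, W, hW⟩ := exists_dilation Z
  have ht0 : 0 < t := by linarith
  set a := ∑' α, ‖wordPow W.1 α i j‖ ^ 2
  have ha : 0 ≤ a := tsum_nonneg fun _ => by positivity
  set b := (1 - t⁻¹ ^ 2)⁻¹ * ‖B.clarkGram [] []‖
  -- The bound from `2ab ≤ a² + b²` is not homogeneous in `F`. It is proved on the unit ball first
  -- and then rescaled.
  have hunit : ∀ F : HerglotzSpace B hB, ‖F‖ ≤ 1 →
      ‖∑' α, wordPow Z.1 α i j • taylorCoeff F.value α‖ ≤ a + b := by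
    intro F hF
    have h0 : 0 < t⁻¹ := by positivity
    have h1 : t⁻¹ < 1 := inv_lt_one_of_one_lt₀ ht
    have hs := subexp_taylorCoeff F _ h0 h1
    have hle : ∑' α : Word d, (t⁻¹ ^ α.length * ‖taylorCoeff F.value α‖) ^ 2 ≤ b := by
      refine hs.tsum_le_of_sum_le fun s => (sum_damped_taylorCoeff_le F h0 h1 s).trans ?_
      have hr : 0 < 1 - t⁻¹ ^ 2 := sub_pos.2 (pow_lt_one₀ h0.le h1 two_ne_zero)
      have hF2 : ‖F‖ ^ 2 ≤ 1 := pow_le_one₀ (norm_nonneg _) hF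
      rw [← mul_assoc]
      exact mul_le_of_le_one_right (by positivity) hF2
    refine (tsum_of_norm_bounded ((summable_entry W i j).hasSum.add hs.hasSum)
      fun α => ?_).trans (add_le_add le_rfl hle)
    have e : ‖wordPow Z.1 α i j • taylorCoeff F.value α‖ =
        ‖wordPow W.1 α i j‖ * (t⁻¹ ^ α.length * ‖taylorCoeff F.value α‖) := by
      rw [wordPow_dilation hW, Matrix.smul_apply, norm_smul, norm_smul, norm_pow,
        Complex.norm_real, Real.norm_of_nonneg ht0.le, inv_pow]
      field_simp
    rw [e]
    nlinarith [sq_nonneg (‖wordPow W.1 α i j‖ - t⁻¹ ^ α.length * ‖taylorCoeff F.value α‖),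
      sq_nonneg (‖wordPow W.1 α i j‖), sq_nonneg (t⁻¹ ^ α.length * ‖taylorCoeff F.value α‖)]
  refine ⟨a + b, fun F => ?_⟩
  by_cases hF : F = 0
  · subst hF
    have : ∀ α : Word d, taylorCoeff (0 : HerglotzSpace B hB).value α = 0 := fun α => by
      rw [← coeffEval_apply, map_zero]
    simp [this]
  · have hF0 : 0 < ‖F‖ := norm_pos_iff.2 hF
    have h1 := hunit (((‖F‖⁻¹ : ℝ) : ℂ) • F) (by simp [norm_smul, hF0.ne'])
    have h2 : ∀ α : Word d, taylorCoeff (((‖F‖⁻¹ : ℝ) : ℂ) • F).value α =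
        ((‖F‖⁻¹ : ℝ) : ℂ) • taylorCoeff F.value α := fun α => by
      rw [← coeffEval_apply, map_smul, coeffEval_apply]
    simp only [h2, smul_comm _ ((‖F‖⁻¹ : ℝ) : ℂ)] at h1
    rw [(summable_series F Z i j).tsum_const_smul, norm_smul, Complex.norm_real, norm_inv,
      norm_norm, inv_mul_le_iff₀ hF0] at h1
    rwa [mul_comm]

/-- The sum of the Taylor-Taylor series at `Z`, as a bounded operator. -/
def seriesEval (B : LeftSchur d H) (hB : B.CayleyDefined) {n : ℕ} (Z : Ball d n) (i j : Fin n) :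
    HerglotzSpace B hB →L[ℂ] H :=
  LinearMap.mkContinuousOfExistsBound
    { toFun := fun F => ∑' α, wordPow Z.1 α i j • taylorCoeff F.value α
      map_add' := fun F G => by
        rw [← (summable_series F Z i j).tsum_add (summable_series G Z i j)]
        simp only [← coeffEval_apply, map_add, smul_add]
      map_smul' := fun c F => by
        rw [RingHom.id_apply, ← (summable_series F Z i j).tsum_const_smul]
        simp only [← coeffEval_apply, map_smul, smul_comm c] }
    (exists_norm_series_le B hB Z i j)

/-- Summing the series and evaluating at `Z` are bounded operators that agree on kernel vectors,
hence everywhere. -/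
theorem hasSum_value (F : HerglotzSpace B hB) {n : ℕ} (Z : Ball d n) (i j : Fin n) :
    HasSum (fun α => wordPow Z.1 α i j • taylorCoeff F.value α) (F.value n Z i j) := by
  have h : seriesEval B hB Z i j = entryEval B hB Z i j := by
    refine ContinuousLinearMap.ext_on ((Submodule.dense_iff_topologicalClosure_eq_top).2
      (RKHS.kerFun_dense (HerglotzSpace B hB) (𝕜 := ℂ))) ?_
    rintro _ ⟨q, g, rfl⟩
    exact (hasSum_value_kerVec q.Z q.y q.v g Z i j).tsum_eq
  have := (summable_series F Z i j).hasSum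
  rwa [show ∑' α, wordPow Z.1 α i j • taylorCoeff F.value α = F.value n Z i j from
    DFunLike.congr_fun h F] at this

end HerglotzSpace

/-! The Taylor-Taylor series of the Herglotz function. -/

theorem szego_origin {n m : ℕ} (Z : Ball d n) (P : Matrix (Fin n) (Fin m) ℂ) :
    szego Z (Ball.origin d m) P = P := by
  ext i k
  rw [szego, Matrix.of_apply, tsum_eq_single []]
  · simp [wordPow]
  · intro α hα
    obtain ⟨j, β, rfl⟩ := List.exists_cons_of_ne_nil hα
    simp [wordPow_cons, Ball.origin]

/-- At the origin the Szegő kernel reduces to the identity map. This kernel vector is thus `½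
H_B(Z)h` plus a constant, which gives access to the series of `H_B`. -/
theorem HerglotzSpace.value_kerVec_origin (B : LeftSchur d H) (hB : B.CayleyDefined) {n : ℕ}
    (Z : Ball d n) (i j : Fin n) (h : H) :
    (kerVec B hB (Ball.origin d 1) 1 1 h).value n Z i j =
      (2⁻¹ : ℂ) • (B.herglotz n Z i j h +
        if i = j then (B.herglotz 1 (Ball.origin d 1))ᴴ 0 0 h else 0) := by
  have e : (kerVec B hB (Ball.origin d 1) 1 1 h).value n Z i j =
      B.gram ⟨n, Z, Pi.single i 1, Pi.single j 1⟩ ⟨1, Ball.origin d 1, 1, 1⟩ h := by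
    rw [value, Matrix.of_apply, kerVec, RKHS.kerFun_apply, kernel_eq]
  have e2 : B.gram ⟨n, Z, Pi.single i 1, Pi.single j 1⟩ ⟨1, Ball.origin d 1, 1, 1⟩ =
      B.herglotzKernel Z (Ball.origin d 1)
        (Matrix.vecMulVec (Pi.single j 1) (star (1 : Fin 1 → ℂ))) i 0 := by
    simp only [LeftSchur.gram, Matrix.of_apply]
    rw [Finset.sum_eq_single i]
    · simp
    · intro b _ hb
      simp [hb]
    · simp
  rw [e, e2, LeftSchur.herglotzKernel, szego_origin, Matrix.smul_apply, Matrix.add_apply,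
    mul_ampl_entry, ampl_mul_entry, Finset.sum_eq_single j]
  · by_cases hij : i = j
    · simp [Matrix.vecMulVec_apply, hij]
    · simp [Matrix.vecMulVec_apply, hij]
  · intro b _ hb
    simp [Matrix.vecMulVec_apply, hb]
  · simp

theorem hasSum_herglotz (B : LeftSchur d H) (hB : B.CayleyDefined) {n : ℕ} (Z : Ball d n)
    (i j : Fin n) (h : H) :
    HasSum (fun α : Word d => wordPow Z.1 α i j • B.herglotzCoeff α h) (B.herglotz n Z i j h) := by
  classical
  set F := HerglotzSpace.kerVec B hB (Ball.origin d 1) 1 1 h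
  set x := (B.herglotz 1 (Ball.origin d 1))ᴴ 0 0 h with hx
  -- Solves the formula at the origin for `H_B(Z)h`: the constant `x` affects only the empty word.
  -- Uniqueness of coefficients later identifies `c` with those of `H_B`.
  let c : Word d → H := fun α => (2 : ℂ) • taylorCoeff F.value α - if α = [] then x else 0
  have key : ∀ (n : ℕ) (Z : Ball d n) (i j : Fin n),
      HasSum (fun α => wordPow Z.1 α i j • c α) (B.herglotz n Z i j h) := by
    intro n Z i j
    have h1 := (HerglotzSpace.hasSum_value F Z i j).const_smul (2 : ℂ)
    have h2 : HasSum (fun α : Word d => wordPow Z.1 α i j • if α = [] then x else 0)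
        (if i = j then x else 0) := by
      convert hasSum_single (f := fun α : Word d => wordPow Z.1 α i j • if α = [] then x else 0) []
        (fun α hα => by simp [hα]) using 1
      simp [wordPow, Matrix.one_apply, ite_smul]
    convert h1.sub h2 using 1
    · funext α
      simp only [c, smul_sub, smul_comm (2 : ℂ)]
    · rw [HerglotzSpace.value_kerVec_origin, smul_smul, ← hx]
      norm_num
  have hc : ∀ α, B.herglotzCoeff α h = c α :=
    taylorCoeff_unique (fun n Z => Matrix.of fun i j => B.herglotz n Z i j h) c key
  simpa only [hc] using key n Z i j

/-! Closed spans. -/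

theorem map_mem_of_mem_closure_span {E E' : Type*} [NormedAddCommGroup E] [InnerProductSpace ℂ E]
    [NormedAddCommGroup E'] [InnerProductSpace ℂ E'] {S : Set E} (T : E →L[ℂ] E')
    {K : Submodule ℂ E'} (hK : IsClosed (K : Set E')) (h : ∀ s ∈ S, T s ∈ K) {x : E}
    (hx : x ∈ (Submodule.span ℂ S).topologicalClosure) : T x ∈ K :=
  Submodule.topologicalClosure_minimal (t := K.comap T.toLinearMap) _ (Submodule.span_le.2 h)
    (hK.preimage T.continuous) hx

theorem mem_orthogonal_span_iff {E : Type*} [NormedAddCommGroup E] [InnerProductSpace ℂ E]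
    {S : Set E} {x : E} : x ∈ (Submodule.span ℂ S)ᗮ ↔ ∀ s ∈ S, ⟪s, x⟫_ℂ = 0 := by
  refine ⟨fun h s hs => h s (Submodule.subset_span hs), fun h s hs => ?_⟩
  induction hs using Submodule.span_induction with
  | mem s hs => exact h s hs
  | zero => exact inner_zero_left _
  | add a b _ _ ha hb => rw [inner_add_left, ha, hb, add_zero]
  | smul c a _ ha => rw [inner_smul_left, ha, mul_zero]

/-! ### Totality of the coefficient kernels and weak expansion of the kernel vectors. -/

namespace HerglotzSpace

variable {B : LeftSchur d H} {hB : B.CayleyDefined}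

theorem ext_taylorCoeff {F G : HerglotzSpace B hB}
    (h : ∀ α, taylorCoeff F.value α = taylorCoeff G.value α) : F = G := by
  refine ext_value fun n Z => ?_
  ext i j
  exact (hasSum_value F Z i j).unique (by simpa only [h] using hasSum_value G Z i j)

theorem ext_inner_coeffKer {F G : HerglotzSpace B hB}
    (h : ∀ α g, ⟪coeffKer B hB α g, F⟫_ℂ = ⟪coeffKer B hB α g, G⟫_ℂ) : F = G :=
  ext_taylorCoeff fun α => ext_inner_left ℂ fun g => by
    rw [← coeffKer_inner_left, ← coeffKer_inner_left, h]

/-- A vector orthogonal to every `K_α h` has only zero coefficients, and by the expansion it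
vanishes. -/
theorem coeffKer_dense (B : LeftSchur d H) (hB : B.CayleyDefined) :
    (Submodule.span ℂ {F | ∃ α h, F = coeffKer B hB α h}).topologicalClosure = ⊤ := by
  refine Submodule.topologicalClosure_eq_top_iff.2 ((Submodule.eq_bot_iff _).2 fun F hF => ?_)
  refine ext_inner_coeffKer fun α g => ?_
  rw [mem_orthogonal_span_iff.1 hF _ ⟨α, g, rfl⟩, inner_zero_right]

theorem clm_ext {E : Type*} [NormedAddCommGroup E] [InnerProductSpace ℂ E]
    {S T : HerglotzSpace B hB →L[ℂ] E} (h : ∀ α g, S (coeffKer B hB α g) = T (coeffKer B hB α g)) :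
    S = T := by
  refine ContinuousLinearMap.ext_on ((Submodule.dense_iff_topologicalClosure_eq_top).2
    (coeffKer_dense B hB)) ?_
  rintro _ ⟨α, g, rfl⟩
  exact h α g

theorem value_origin (F : HerglotzSpace B hB) (n : ℕ) :
    F.value n (Ball.origin d n) = Matrix.diagonal fun _ => taylorCoeff F.value [] := by
  ext i j
  refine (hasSum_value F _ i j).unique ?_
  convert hasSum_single (f := fun α => wordPow (Ball.origin d n).1 α i j •
    taylorCoeff F.value α) [] (fun α hα => ?_) using 1
  · by_cases h : i = j <;> simp [wordPow, h]
  · obtain ⟨j, β, rfl⟩ := List.exists_cons_of_ne_nil hα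
    simp [wordPow_cons, Ball.origin]

theorem value_eq_diagonal {F : HerglotzSpace B hB} (h : ∀ α ≠ [], taylorCoeff F.value α = 0)
    {n : ℕ} (Z : Ball d n) : F.value n Z = Matrix.diagonal fun _ => taylorCoeff F.value [] := by
  ext i j
  refine (hasSum_value F _ i j).unique ?_
  convert hasSum_single (f := fun α => wordPow Z.1 α i j •
    taylorCoeff F.value α) [] (fun α hα => ?_) using 1
  · by_cases h : i = j <;> simp [wordPow, h]
  · simp [h α hα]

/-- The weak expansion of a kernel vector in coefficient kernels. It reduces identities for
`K{Z,y,v}` to identities for `K_α`. -/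
theorem hasSum_inner_kerVec (F : HerglotzSpace B hB) {n : ℕ} (Z : Ball d n) (y v : Fin n → ℂ)
    (h : H) : HasSum (fun α => (star y ⬝ᵥ (wordPow Z.1 α *ᵥ v)) * ⟪coeffKer B hB α h, F⟫_ℂ)
      ⟪kerVec B hB Z y v h, F⟫_ℂ := by
  rw [kerVec_inner_left]
  have h1 : ∀ i j, HasSum (fun α => ⟪y i • h, v j • wordPow Z.1 α i j • taylorCoeff F.value α⟫_ℂ)
      ⟪y i • h, v j • F.value n Z i j⟫_ℂ := fun i j =>
    (innerSL ℂ (y i • h)).hasSum ((hasSum_value F Z i j).const_smul (v j))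
  refine (hasSum_sum fun i (_ : i ∈ Finset.univ) => hasSum_sum fun j (_ : j ∈ Finset.univ) =>
    h1 i j).congr_fun fun α => ?_
  simp only [coeffKer_inner_left, inner_smul_left, inner_smul_right, dotProduct, Matrix.mulVec,
    Pi.star_apply, RCLike.star_def, Finset.mul_sum, Finset.sum_mul]
  exact Finset.sum_congr rfl fun i _ => Finset.sum_congr rfl fun j _ => by ring

theorem inner_kerVec_origin (F : HerglotzSpace B hB) {n : ℕ} (y v : Fin n → ℂ) (h : H) :
    ⟪kerVec B hB (Ball.origin d n) y v h, F⟫_ℂ = (star y ⬝ᵥ v) * ⟪coeffKer B hB [] h, F⟫_ℂ := by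
  refine (hasSum_inner_kerVec F _ y v h).unique ?_
  convert hasSum_single (f := fun α => (star y ⬝ᵥ (wordPow (Ball.origin d n).1 α *ᵥ v)) *
    ⟪coeffKer B hB α h, F⟫_ℂ) [] (fun α hα => ?_) using 1
  · simp [wordPow]
  · obtain ⟨j, β, rfl⟩ := List.exists_cons_of_ne_nil hα
    simp [wordPow_cons, Ball.origin]

/-- Both spanning sets of the range of `V^B` have the same closed span. -/
theorem closure_span_kerVec_sub (B : LeftSchur d H) (hB : B.CayleyDefined) :
    (Submodule.span ℂ {F | ∃ (n : ℕ) (Z : Ball d n) (y v : Fin n → ℂ) (h : H),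
      F = kerVec B hB Z y v h - kerVec B hB (Ball.origin d n) y v h}).topologicalClosure =
    (Submodule.span ℂ {F | ∃ (α : Word d) (h : H), α ≠ [] ∧
      F = coeffKer B hB α h}).topologicalClosure := by
  -- Orthogonality to either spanning set means that all coefficients of nonempty words vanish, so
  -- the orthogonal complements are compared.
  rw [← Submodule.orthogonal_orthogonal_eq_closure, ← Submodule.orthogonal_orthogonal_eq_closure]
  congr 1
  ext F
  rw [mem_orthogonal_span_iff, mem_orthogonal_span_iff]
  constructor
  · rintro h _ ⟨α, g, hα, rfl⟩
    have h1 := h _ ⟨_, shiftPoint α, Pi.single 0 1, Pi.single (Fin.last _) 1, g, rfl⟩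
    -- For `α ≠ ∅` the first and last basis vectors are distinct, so the origin term `⟨y, v⟩` is
    -- zero and the difference pairs with `F` like a multiple of `K_α`.
    have hne : (0 : Fin (α.length + 1)) ≠ Fin.last _ := fun he =>
      hα (List.length_eq_zero_iff.1 (congrArg Fin.val he).symm)
    rw [inner_sub_left, inner_kerVec_origin] at h1
    have h2 : star (Pi.single 0 1 : Fin (α.length + 1) → ℂ) ⬝ᵥ Pi.single (Fin.last _) 1 = 0 := by
      simp [dotProduct_single, hne.symm]
    rw [h2, zero_mul, sub_zero] at h1
    rw [coeffKer_eq, inner_smul_left, h1, mul_zero]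
  · rintro h _ ⟨n, Z, y, v, g, rfl⟩
    have h1 : ∀ α ≠ [], taylorCoeff F.value α = 0 := fun α hα => ext_inner_left ℂ fun g => by
      rw [← coeffKer_inner_left, h _ ⟨α, g, hα, rfl⟩, inner_zero_right]
    rw [inner_sub_left, kerVec_inner_left, kerVec_inner_left, value_origin, value_eq_diagonal h1,
      sub_self]

end HerglotzSpace

/-! Unitarity of the Cauchy transform. -/

namespace ClarkSpace

variable (B : LeftSchur d H) (hB : B.CayleyDefined)

variable {B hB} in
theorem ext_inner_mono {x y : ClarkSpace B hB}
    (h : ∀ α g, ⟪mono B hB α g, x⟫_ℂ = ⟪mono B hB α g, y⟫_ℂ) : x = y := by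
  refine RKHS.ext fun α => ext_inner_left ℂ fun g => ?_
  rw [← RKHS.kerFun_inner, ← RKHS.kerFun_inner]
  exact h α g

/-- The Gram matrices of the `K_α` and of the `L^{α†}` coincide. The adjoint therefore inverts the
Cauchy transform on total sets, whence unitarity. -/
theorem adjoint_cauchy_coeffKer (α : Word d) (h : H) :
    ContinuousLinearMap.adjoint (cauchy B hB) (HerglotzSpace.coeffKer B hB α h) =
      mono B hB α.reverse h := by
  refine ext_inner_mono fun β g => ?_
  rw [ContinuousLinearMap.adjoint_inner_right, cauchy_mono, HerglotzSpace.coeffKer_inner,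
    mono_inner, List.reverse_reverse]

theorem cauchy_adjoint_cauchy (F : HerglotzSpace B hB) :
    cauchy B hB (ContinuousLinearMap.adjoint (cauchy B hB) F) = F := by
  have : cauchy B hB ∘L ContinuousLinearMap.adjoint (cauchy B hB) =
      ContinuousLinearMap.id ℂ (HerglotzSpace B hB) := HerglotzSpace.clm_ext fun α g => by
    rw [ContinuousLinearMap.comp_apply, adjoint_cauchy_coeffKer, cauchy_mono,
      List.reverse_reverse, ContinuousLinearMap.id_apply]
  exact DFunLike.congr_fun this F

theorem adjoint_cauchy_cauchy (x : ClarkSpace B hB) :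
    ContinuousLinearMap.adjoint (cauchy B hB) (cauchy B hB x) = x := by
  refine ext_inner_mono fun α g => ?_
  rw [← List.reverse_reverse α, ← adjoint_cauchy_coeffKer, ContinuousLinearMap.adjoint_inner_left,
    ContinuousLinearMap.adjoint_inner_left, cauchy_adjoint_cauchy]

end ClarkSpace

/-! The row isometry. -/

namespace LeftSchur

open HerglotzSpace

variable (B : LeftSchur d H) (hB : B.CayleyDefined)

/-- Word reversal in the Cauchy transform turns prepending a letter into appending it. -/
theorem V_coeffKer (j : Fin d) (α : Word d) (h : H) :
    B.V hB j (coeffKer B hB α h) = coeffKer B hB (α ++ [j]) h := by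
  simp only [V, ContinuousLinearMap.comp_apply, ClarkSpace.adjoint_cauchy_coeffKer,
    ClarkSpace.gns_mono, ClarkSpace.cauchy_mono, List.reverse_cons, List.reverse_reverse]

/-- On reversed words this is `L_i^* L_j = δ_{ij}`: the Clark Gram matrix ignores a common first
letter and vanishes when the first letters differ. -/
theorem adjoint_V_V (i j : Fin d) (F : HerglotzSpace B hB) :
    ContinuousLinearMap.adjoint (B.V hB i) (B.V hB j F) = if i = j then F else 0 := by
  have : ContinuousLinearMap.adjoint (B.V hB i) ∘L B.V hB j =
      if i = j then ContinuousLinearMap.id ℂ (HerglotzSpace B hB) else 0 := by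
    refine clm_ext fun α g => ext_inner_coeffKer fun β k => ?_
    rw [ContinuousLinearMap.comp_apply, ContinuousLinearMap.adjoint_inner_right, V_coeffKer,
      V_coeffKer, coeffKer_inner, List.reverse_append, List.reverse_append]
    by_cases h : i = j
    · subst h
      simp [ClarkSpace.clarkGram_cons, coeffKer_inner]
    · have h' : ¬ j = i := fun e => h e.symm
      simp [h, h', clarkGram]
  have := DFunLike.congr_fun this F
  rw [ContinuousLinearMap.comp_apply] at this
  rw [this]
  split_ifs <;> simp

theorem inner_V_V (i j : Fin d) (F G : HerglotzSpace B hB) :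
    ⟪B.V hB i F, B.V hB j G⟫_ℂ = if i = j then ⟪F, G⟫_ℂ else 0 := by
  rw [← ContinuousLinearMap.adjoint_inner_right, adjoint_V_V]
  split_ifs <;> simp

theorem row_apply (x : PiLp 2 fun _ : Fin d => HerglotzSpace B hB) :
    B.row hB x = ∑ j, B.V hB j (x j) := by
  simp [row]

theorem isometry_row : Isometry (B.row hB) := by
  refine AddMonoidHomClass.isometry_of_norm _ fun x => ?_
  rw [← sq_eq_sq₀ (norm_nonneg _) (norm_nonneg _), ← inner_self_eq_norm_sq (𝕜 := ℂ),
    ← inner_self_eq_norm_sq (𝕜 := ℂ), row_apply, PiLp.inner_apply]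
  simp only [sum_inner, inner_sum, inner_V_V, Finset.sum_ite_eq', Finset.mem_univ, if_true]

theorem isClosed_range_row : IsClosed ((B.row hB).range : Set (HerglotzSpace B hB)) := by
  have e : ((B.row hB).range : Set (HerglotzSpace B hB)) = Set.range (B.row hB) := rfl
  rw [e]
  exact (B.isometry_row hB).isClosedEmbedding.isClosed_range

theorem V_mem_range_row (j : Fin d) (F : HerglotzSpace B hB) :
    B.V hB j F ∈ (B.row hB).range := by
  refine ⟨WithLp.toLp 2 (Pi.single j F), ?_⟩
  change B.row hB _ = _
  rw [row_apply, Finset.sum_eq_single j]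
  · simp
  · intro i _ hi
    simp [hi]
  · simp

/-- Each `V_j` maps the total set of `K_α` to kernels of nonempty words. Conversely every nonempty
word has a last letter, and an isometry has closed range. -/
theorem range_row : (B.row hB).range = (Submodule.span ℂ {F | ∃ (α : Word d) (h : H), α ≠ [] ∧
    F = coeffKer B hB α h}).topologicalClosure := by
  refine le_antisymm ?_ (Submodule.topologicalClosure_minimal _ (Submodule.span_le.2 ?_)
    (B.isClosed_range_row hB))
  · rintro _ ⟨x, rfl⟩
    change B.row hB x ∈ _
    rw [row_apply]
    refine Submodule.sum_mem _ fun j _ => ?_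
    refine map_mem_of_mem_closure_span (B.V hB j) (Submodule.isClosed_topologicalClosure _) ?_
      ((coeffKer_dense B hB).symm ▸ Submodule.mem_top)
    rintro _ ⟨α, h, rfl⟩
    rw [V_coeffKer]
    exact Submodule.le_topologicalClosure _ (Submodule.subset_span ⟨_, h, by simp, rfl⟩)
  · rintro _ ⟨α, h, hα, rfl⟩
    rw [← List.dropLast_append_getLast hα, ← V_coeffKer]
    exact B.V_mem_range_row hB _ _

theorem adjoint_V_kerVec_sub {n : ℕ} (Z : Ball d n) (y v : Fin n → ℂ) (h : H) (j : Fin d) :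
    ContinuousLinearMap.adjoint (B.V hB j)
      (kerVec B hB Z y v h - kerVec B hB (Ball.origin d n) y v h) =
      kerVec B hB Z y (Matrix.mulVec (Z.1 j) v) h := by
  refine ext_inner_right ℂ fun F => ?_
  rw [ContinuousLinearMap.adjoint_inner_left, inner_sub_left, inner_kerVec_origin]
  -- Subtracting the origin vector deletes exactly the empty-word term of the expansion.
  have h1 := (hasSum_inner_kerVec (B.V hB j F) Z y v h).sub
    (hasSum_ite_eq [] ((star y ⬝ᵥ v) * ⟪coeffKer B hB [] h, B.V hB j F⟫_ℂ))
  have hinj : Function.Injective fun β : Word d => β ++ [j] := List.append_left_injective _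
  -- The sum can be reindexed over the words `βj`. A word ending in `i ≠ j` contributes nothing,
  -- because the ranges of `V_i` and `V_j` are orthogonal.
  refine ((hinj.hasSum_iff fun α hα => ?_).2 h1).unique
    ((hasSum_inner_kerVec F Z y _ h).congr_fun fun β => ?_)
  · rcases List.eq_nil_or_concat' α with rfl | ⟨β, i, rfl⟩
    · simp [wordPow]
    · have hij : i ≠ j := fun e => hα ⟨β, by simp [e]⟩
      rw [← V_coeffKer, inner_V_V, if_neg hij]
      simp
  · simp only [Function.comp_apply]
    rw [← V_coeffKer, inner_V_V, if_pos rfl, if_neg (by simp), sub_zero, wordPow_append,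
      ← Matrix.mulVec_mulVec]
    simp [wordPow]

/-- By the adjoint formula, `x` orthogonal to these vectors means that its image under the row is
orthogonal to the differences spanning the range. The image, lying in the range, is then zero, and
the row is injective. -/
theorem closure_span_shifted_kerVec :
    (Submodule.span ℂ {G : PiLp 2 (fun _ : Fin d => HerglotzSpace B hB) |
      ∃ (n : ℕ) (Z : Ball d n) (y v : Fin n → ℂ) (h : H), G = WithLp.toLp 2 (fun j =>
        kerVec B hB Z y (Matrix.mulVec (Z.1 j) v) h)}).topologicalClosure = ⊤ := by
  refine Submodule.topologicalClosure_eq_top_iff.2 ((Submodule.eq_bot_iff _).2 fun x hx => ?_)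
  rw [mem_orthogonal_span_iff] at hx
  have h1 : B.row hB x ∈ (B.row hB).rangeᗮ := by
    rw [range_row, ← closure_span_kerVec_sub, Submodule.orthogonal_closure,
      mem_orthogonal_span_iff]
    rintro _ ⟨n, Z, y, v, h, rfl⟩
    have := hx _ ⟨n, Z, y, v, h, rfl⟩
    rw [PiLp.inner_apply] at this
    rw [row_apply, inner_sum, ← this]
    refine Finset.sum_congr rfl fun j _ => ?_
    rw [← ContinuousLinearMap.adjoint_inner_left, adjoint_V_kerVec_sub]
  have h2 : B.row hB x = 0 := inner_self_eq_zero.1 (h1 _ ⟨x, rfl⟩)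
  exact (B.isometry_row hB).injective (h2.trans (map_zero _).symm)

/-- The adjoint exchanges `K_α` with `L^{α†}`, and reversal preserves nonemptiness. No closure is
needed on the left, because the Cauchy transform itself supplies preimages. -/
theorem map_adjoint_cauchy_range_row :
    (B.row hB).range.map (ContinuousLinearMap.adjoint (ClarkSpace.cauchy B hB)).toLinearMap =
      ClarkSpace.nonconstant B hB := by
  refine le_antisymm (Submodule.map_le_iff_le_comap.2 fun F hF => ?_) fun x hx => ?_
  · rw [range_row] at hF
    refine map_mem_of_mem_closure_span (ContinuousLinearMap.adjoint (ClarkSpace.cauchy B hB))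
      (Submodule.isClosed_topologicalClosure _) ?_ hF
    rintro _ ⟨α, h, hα, rfl⟩
    rw [ClarkSpace.adjoint_cauchy_coeffKer]
    exact Submodule.le_topologicalClosure _ (Submodule.subset_span ⟨_, h, by simpa using hα, rfl⟩)
  · refine ⟨ClarkSpace.cauchy B hB x, ?_, ClarkSpace.adjoint_cauchy_cauchy B hB x⟩
    refine map_mem_of_mem_closure_span (ClarkSpace.cauchy B hB) (B.isClosed_range_row hB) ?_ hx
    rintro _ ⟨α, h, hα, rfl⟩
    rw [ClarkSpace.cauchy_mono, range_row]
    exact Submodule.le_topologicalClosure _ (Submodule.subset_span ⟨_, h, by simpa using hα, rfl⟩)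

theorem exists_value_eq_diagonal {F : HerglotzSpace B hB} (hF : F ∈ (B.row hB).rangeᗮ) :
    ∃ f : H, ∀ (n : ℕ) (Z : Ball d n), F.value n Z = Matrix.diagonal fun _ => f := by
  rw [range_row, Submodule.orthogonal_closure, mem_orthogonal_span_iff] at hF
  refine ⟨taylorCoeff F.value [], fun n Z => value_eq_diagonal (fun α hα => ?_) Z⟩
  refine ext_inner_left ℂ fun g => ?_
  rw [← coeffKer_inner_left, hF _ ⟨α, g, hα, rfl⟩, inner_zero_right]

end LeftSchur

end FreeHerglotz

end

open FreeHerglotz in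
theorem proposition4p1 {d : ℕ} {H : Type*} [NormedAddCommGroup H] [InnerProductSpace ℂ H]
    [CompleteSpace H] (B : LeftSchur d H) (hB : B.CayleyDefined) :
    -- the Taylor-Taylor series of `H_B` and of the elements of the Herglotz space
    (∀ (n : ℕ) (Z : Ball d n) (i j : Fin n) (h : H),
      HasSum (fun α : Word d => wordPow Z.1 α i j • B.herglotzCoeff α h) (B.herglotz n Z i j h)) ∧
    (∀ (F : HerglotzSpace B hB) (n : ℕ) (Z : Ball d n) (i j : Fin n),
      HasSum (fun α : Word d => wordPow Z.1 α i j • taylorCoeff F.value α) (F.value n Z i j)) ∧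
    -- `V^B` is a row isometry
    Isometry (B.row hB) ∧
    -- its range
    (B.row hB).range = (Submodule.span ℂ {F | ∃ (n : ℕ) (Z : Ball d n) (y v : Fin n → ℂ) (h : H),
      F = HerglotzSpace.kerVec B hB Z y v h -
        HerglotzSpace.kerVec B hB (Ball.origin d n) y v h}).topologicalClosure ∧
    (B.row hB).range = (Submodule.span ℂ {F | ∃ (α : Word d) (h : H), α ≠ [] ∧
      F = HerglotzSpace.coeffKer B hB α h}).topologicalClosure ∧
    -- the adjoint
    (∀ (n : ℕ) (Z : Ball d n) (y v : Fin n → ℂ) (h : H) (j : Fin d),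
      ContinuousLinearMap.adjoint (B.V hB j)
        (HerglotzSpace.kerVec B hB Z y v h - HerglotzSpace.kerVec B hB (Ball.origin d n) y v h) =
      HerglotzSpace.kerVec B hB Z y (Matrix.mulVec (Z.1 j) v) h) ∧
    (Submodule.span ℂ {G : PiLp 2 (fun _ : Fin d => HerglotzSpace B hB) |
      ∃ (n : ℕ) (Z : Ball d n) (y v : Fin n → ℂ) (h : H), G = WithLp.toLp 2 (fun j =>
        HerglotzSpace.kerVec B hB Z y (Matrix.mulVec (Z.1 j) v) h)}).topologicalClosure = ⊤ ∧
    -- the image of the range under the adjoint of the Cauchy transform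
    (B.row hB).range.map (ContinuousLinearMap.adjoint (ClarkSpace.cauchy B hB)).toLinearMap =
      ClarkSpace.nonconstant B hB ∧
    -- elements orthogonal to the range are constant
    (∀ F : HerglotzSpace B hB, F ∈ (B.row hB).rangeᗮ →
      ∃ f : H, ∀ (n : ℕ) (Z : Ball d n), F.value n Z = Matrix.diagonal fun _ => f) := by
  refine ⟨fun n Z i j h => hasSum_herglotz B hB Z i j h,
    fun F n Z i j => HerglotzSpace.hasSum_value F Z i j, B.isometry_row hB, ?_, B.range_row hB,
    fun n Z y v h j => B.adjoint_V_kerVec_sub hB Z y v h j, B.closure_span_shifted_kerVec hB,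
    B.map_adjoint_cauchy_range_row hB, fun F hF => B.exists_value_eq_diagonal hB hF⟩
  rw [HerglotzSpace.closure_span_kerVec_sub, B.range_row hB]
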